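/- Let $\tau=(1+\sqrt5)/2$, let $\mathcal I=\{(0,\pm\tau,\pm1),(\pm1,0,\pm\tau),(\pm\tau,\pm1,0)\}\subset\mathbb R^3$ be the set of the twelve vertices of the regular icosahedron, and let $R_+$ be the set of fifteen positive roots of type $H_3$, $$R_+=\{(2,0,0),(0,2,0),(0,0,2),(\tau,\pm\tau^{-1},\pm1),(\pm1,\tau,\pm\tau^{-1}),(\tau^{-1},\pm1,\tau),(-\tau^{-1},1,\tau),(\tau^{-1},1,-\tau)\}.$$ Let $\kappa\ge 0$ and $\omega>0$ be real. Write $(a)_n=a(a+1)\cdots(a+n-1)$, and put $$\nu(n)=2^n\,(6\kappa+1)_{\lfloor n/2\rfloor}\,\bigl(5\kappa+\tfrac12\bigr)_{\lfloor (n+1)/2\rfloor}.$$ For $y_0\in\mathcal I$ let the polynomials $q_n(x;y_0)$ in $x\in\mathbb R^3$ be given by $$(1-r\langle x,y_0\rangle)^{-1}\prod_{y\in\mathcal I}(1-r\langle x,y\rangle)^{-\kappa}=\sum_{n\ge0}q_n(x;y_0)\,r^n,$$ and for $n\ge0$ let $$\phi_n(x;y_0)=\sum_{j=0}^{\lfloor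 n/2\rfloor}\frac{(\tau+2)^j\,|x|^{2j}}{4^j\,j!\,(-15\kappa-n+\frac12)_j}\,\frac{\nu(n)}{\nu(n-2j)}\,q_{n-2j}(x;y_0).$$ Let $h_\kappa(x)=\prod_{v\in R_+}|\langle x,v\rangle|^{\kappa}$ and, for polynomials $p,p'$ on $\mathbb R^3$, $$\langle p,p'\rangle_2=c_{\kappa,\omega}\int_{\mathbb R^3}p(x)\,p'(x)\,e^{-\omega|x|^2}h_\kappa(x)^2\,dx,\qquad c_{\kappa,\omega}^{-1}=\int_{\mathbb R^3}e^{-\omega|x|^2}h_\kappa(x)^2\,dx .$$ Theorem. For all $n\ge0$ and $y_0,y_1\in\mathcal I$, the integral defining $\langle\phi_n(\cdot;y_0),\phi_n(\cdot;y_1)\rangle_2$ converges absolutely and $$\langle\phi_n(\cdot;y_0),\phi_n(\cdot;y_1)\rangle_2=\sum_{j=0}^{\lfloor n/2\rfloor}\frac{(2\omega)^{-n}(\tau+2)^{2j}}{4^j\,j!\,(-15\kappa-n+\frac12)_j}\,\frac{\nu(n)^2}{\nu(n-2j)}\,q_{n-2j}(y_0;y_1).$$ Moreover, $$\langle\phi_n(\cdot;y_0),\phi_n(\cdot;y_1)\rangle_2=\nu(n)\,(2\omega)^{-n}\,\phi_n(y_1;y_0).$$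 -/

import Mathlib

open MeasureTheory

namespace Icosahedral

noncomputable section

/-- The golden ratio `(1 + √5) / 2`. -/
abbrev τ : ℝ := Real.goldenRatio

/-- The fifteen positive roots of the root system of type `H₃`, all of squared length `4`. -/
def posRoots : Finset (Fin 3 → ℝ) :=
  {![2, 0, 0], ![0, 2, 0], ![0, 0, 2],
   ![τ, τ⁻¹, 1], ![τ, τ⁻¹, -1], ![τ, -τ⁻¹, 1], ![τ, -τ⁻¹, -1],
   ![1, τ, τ⁻¹], ![1, τ, -τ⁻¹], ![-1, τ, τ⁻¹], ![-1, τ, -τ⁻¹],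
   ![τ⁻¹, 1, τ], ![τ⁻¹, -1, τ], ![-τ⁻¹, 1, τ], ![τ⁻¹, 1, -τ]}

/-- The twelve vertices of the regular icosahedron. -/
def icosahedron : Finset (Fin 3 → ℝ) :=
  {![0, τ, 1], ![0, τ, -1], ![0, -τ, 1], ![0, -τ, -1],
   ![1, 0, τ], ![1, 0, -τ], ![-1, 0, τ], ![-1, 0, -τ],
   ![τ, 1, 0], ![τ, -1, 0], ![-τ, 1, 0], ![-τ, -1, 0]}

/-- The Pochhammer symbol `(a)_n = a (a + 1) ⋯ (a + n - 1)`. -/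
def poch (a : ℝ) (n : ℕ) : ℝ := (ascPochhammer ℝ n).eval a

/-- Polynomials in `x₁, x₂, x₃` with real coefficients. -/
abbrev Poly : Type := MvPolynomial (Fin 3) ℝ

/-- The linear form `x ↦ ⟨x, y⟩` as a polynomial. -/
def lin (y : Fin 3 → ℝ) : Poly := ∑ i, MvPolynomial.C (y i) * MvPolynomial.X i

/-- `|x|²` as a polynomial. -/
def normSq : Poly := ∑ i, MvPolynomial.X i ^ 2

/-- The formal power series `(1 - r ⟨x, y⟩) ^ a` in the variable `r`, whose coefficients are
polynomials in `x`: the binomial series of `(1 + s) ^ a` at `s = -r ⟨x, y⟩`. -/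
def oneSubPow (y : Fin 3 → ℝ) (a : ℝ) : PowerSeries Poly :=
  PowerSeries.rescale (-lin y) (PowerSeries.binomialSeries Poly a)

/-- The generating function
`F(r, x; y₀) = (1 - r ⟨x, y₀⟩)⁻¹ ∏_{y ∈ icosahedron} (1 - r ⟨x, y⟩) ^ (-κ)`,
as a power series in `r` with coefficients polynomials in `x`. -/
def genFun (κ : ℝ) (y₀ : Fin 3 → ℝ) : PowerSeries Poly :=
  oneSubPow y₀ (-1) * ∏ y ∈ icosahedron, oneSubPow y (-κ)

/-- `q_n(x; y₀)`, the coefficient of `r ^ n` in `F(r, x; y₀)`. -/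
def q (κ : ℝ) (n : ℕ) (y₀ : Fin 3 → ℝ) : Poly := PowerSeries.coeff n (genFun κ y₀)

/-- `ν(n) = 2 ^ n (6κ + 1)_{⌊n/2⌋} (5κ + 1/2)_{⌊(n+1)/2⌋}`. -/
def nu (κ : ℝ) (n : ℕ) : ℝ :=
  2 ^ n * poch (6 * κ + 1) (n / 2) * poch (5 * κ + 1 / 2) ((n + 1) / 2)

/-- The polynomial `φ_n(x; y₀)`. -/
def phi (κ : ℝ) (n : ℕ) (y₀ : Fin 3 → ℝ) : Poly :=
  ∑ j ∈ Finset.range (n / 2 + 1),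
    MvPolynomial.C
      ((τ + 2) ^ j / (4 ^ j * (j.factorial : ℝ) * poch (-15 * κ - n + 1 / 2) j)
        * (nu κ n / nu κ (n - 2 * j)))
      * normSq ^ j * q κ (n - 2 * j) y₀

/-- The weight `h_κ(x) = ∏_{v ∈ R₊} |⟨x, v⟩| ^ κ`. -/
def weight (κ : ℝ) (x : Fin 3 → ℝ) : ℝ := ∏ v ∈ posRoots, |x ⬝ᵥ v| ^ κ

/-- The density `exp(-ω |x|²) h_κ(x)²` with respect to Lebesgue measure on `ℝ³`. -/
def density (κ ω : ℝ) (x : Fin 3 → ℝ) : ℝ := Real.exp (-ω * (x ⬝ᵥ x)) * weight κ x ^ 2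

/-- The normalization constant `c_{κ,ω}`, with `c_{κ,ω}⁻¹ = ∫ exp(-ω |x|²) h_κ(x)² dx`. -/
def normConst (κ ω : ℝ) : ℝ := (∫ x : Fin 3 → ℝ, density κ ω x)⁻¹

/-- The inner product
`⟨p, q⟩₂ = c_{κ,ω} ∫ p(x) q(x) exp(-ω |x|²) h_κ(x)² dx` on polynomials. -/
def inner₂ (κ ω : ℝ) (p p' : Poly) : ℝ :=
  normConst κ ω *
    ∫ x : Fin 3 → ℝ, MvPolynomial.eval x p * MvPolynomial.eval x p' * density κ ω x

end

end Icosahedral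

namespace Icosahedral

/-! Let `T_i` be the Dunkl operators of type `H₃` (`dunkl`), `Δ = ∑ T_i²`, and `y` a vertex. The key
algebraic fact is that `T_i q_{n+1}(·;y)` equals `y_i q_n(·;y)` times `ν(n+1)/ν(n)`
(`dunkl_q_succ`). Hence `K_n = q_n/ν(n)` satisfies `T_i K_{n+1} = y_i K_n` and `Δ K_{n+2} = (τ+2)
K_n`: it plays the role of the degree `n` part of the Dunkl kernel at `y`, with no need for the
intertwining operator. By these rules `φ_n` is `ν(n) K_n` plus a multiple of `|x|²`, with
coefficients that make it harmonic (`dunklLap_phi`).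

Let `E` be the normalized integral. The algebra uses only that `E 1 = 1`, that `E` is invariant
under reflections, and integration by parts for `T_i` (`IsDunklGaussian`). These make `2ω⟨x,T⟩ - Δ`
symmetric, so harmonic polynomials of degree `n` are orthogonal to lower degrees
(`map_mul_eq_zero`). With `H_n = exp(-Δ/(4ω)) K_n` one gets `(2ω)^n E(H_n(·;y) r) = r(y)` for `r`
homogeneous of degree `n` (`map_hermite_mul`). The proof is by induction on `n`; the error, as a
function on the twelve vertices, solves a linear system that a maximum principle forces to be zero.
For harmonic `r` the lower terms of `H_n` drop out and `K_n` itself reproduces (`map_ker_mul`).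
Taking `r = φ_n(·;y₁)`, the inner product is `ν(n) E(K_n(·;y₀) φ_n(·;y₁)) = ν(n)(2ω)^{-n}
φ_n(y₀;y₁)`; the sum in the theorem is its expansion, with `|y₀|² = τ+2`.

Integration by parts is the analytic point, since the weight is singular on the mirrors. It is done
with `⟨x,v⟩² + ε` in place of `⟨x,v⟩²`, where oddness under reflections removes the singular terms,
and then `ε → 0`. -/

/-! ### Roots and vertices of type `H₃` over `ℤ[τ]`. -/

/-- The reflection `x ↦ x - (⟨x, v⟩ / 2) v`, orthogonal when `|v|² = 4`. -/
noncomputable def reflV (v x : Fin 3 → ℝ) : Fin 3 → ℝ := x - (x ⬝ᵥ v / 2) • v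

/-- The real number `a + b τ` represented by a pair `(a, b)` of integers. -/
noncomputable def evZ (p : ℤ × ℤ) : ℝ := p.1 + p.2 * τ

/-- The product of `ℤ[τ]` on pairs of coordinates. -/
def mulZ (p r : ℤ × ℤ) : ℤ × ℤ := (p.1 * r.1 + p.2 * r.2, p.1 * r.2 + p.2 * r.1 + p.2 * r.2)

/-- The dot product on `ℤ[τ]³`. -/
def dotZ (v w : Fin 3 → ℤ × ℤ) : ℤ × ℤ := mulZ (v 0) (w 0) + mulZ (v 1) (w 1) + mulZ (v 2) (w 2)

/-- Halving of the coordinates, meaningful for even ones. -/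
def halfZ (p : ℤ × ℤ) : ℤ × ℤ := (p.1 / 2, p.2 / 2)

/-- The reflection `reflV` on `ℤ[τ]³`. -/
def reflZ (v x : Fin 3 → ℤ × ℤ) : Fin 3 → ℤ × ℤ := fun i => x i - mulZ (halfZ (dotZ x v)) (v i)

/-- The vector in `ℝ³` represented by a vector over `ℤ[τ]`. -/
noncomputable def evV (v : Fin 3 → ℤ × ℤ) : Fin 3 → ℝ := fun i => evZ (v i)

/-- The positive roots over `ℤ[τ]`. -/
def rootsZ : Finset (Fin 3 → ℤ × ℤ) :=
  {![(2,0), 0, 0], ![0, (2,0), 0], ![0, 0, (2,0)],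
   ![(0,1), (-1,1), (1,0)], ![(0,1), (-1,1), (-1,0)], ![(0,1), (1,-1), (1,0)],
   ![(0,1), (1,-1), (-1,0)],
   ![(1,0), (0,1), (-1,1)], ![(1,0), (0,1), (1,-1)], ![(-1,0), (0,1), (-1,1)],
   ![(-1,0), (0,1), (1,-1)],
   ![(-1,1), (1,0), (0,1)], ![(-1,1), (-1,0), (0,1)], ![(1,-1), (1,0), (0,1)],
   ![(-1,1), (1,0), (0,-1)]}

/-- The vertices of the icosahedron over `ℤ[τ]`. -/
def vertsZ : Finset (Fin 3 → ℤ × ℤ) :=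
  {![0, (0,1), (1,0)], ![0, (0,1), (-1,0)], ![0, (0,-1), (1,0)], ![0, (0,-1), (-1,0)],
   ![(1,0), 0, (0,1)], ![(1,0), 0, (0,-1)], ![(-1,0), 0, (0,1)], ![(-1,0), 0, (0,-1)],
   ![(0,1), (1,0), 0], ![(0,1), (-1,0), 0], ![(0,-1), (1,0), 0], ![(0,-1), (-1,0), 0]}

lemma tau_sq : τ * τ = τ + 1 := by
  have := Real.goldenRatio_sq
  rw [sq] at this
  exact this

lemma tau_inv : τ⁻¹ = τ - 1 :=
  inv_eq_of_mul_eq_one_right (by linear_combination tau_sq)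

lemma evZ_add (p r : ℤ × ℤ) : evZ (p + r) = evZ p + evZ r := by
  simp [evZ]; ring

lemma evZ_sub (p r : ℤ × ℤ) : evZ (p - r) = evZ p - evZ r := by
  simp [evZ]; ring

lemma evZ_neg (p : ℤ × ℤ) : evZ (-p) = -evZ p := by
  simp [evZ]; ring

lemma evZ_mulZ (p r : ℤ × ℤ) : evZ (mulZ p r) = evZ p * evZ r := by
  simp only [evZ, mulZ]
  push_cast
  linear_combination (-(p.2 : ℝ) * r.2) * tau_sq

lemma evZ_halfZ {p : ℤ × ℤ} (h : 2 ∣ p.1 ∧ 2 ∣ p.2) : evZ (halfZ p) = evZ p / 2 := by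
  obtain ⟨⟨a, ha⟩, ⟨b, hb⟩⟩ := h
  simp [evZ, halfZ, ha, hb]
  ring

/-- Irrationality of `τ` lets sums and products over the real roots and vertices be moved to integer
pairs, where finite facts are settled by computation. -/
lemma evZ_injective : Function.Injective evZ := by
  rintro ⟨a, b⟩ ⟨c, d⟩ h
  simp only [evZ] at h
  have hbd : b = d := by
    by_contra hne
    have hirr : Irrational (((b - d : ℤ) : ℝ) * τ) :=
      Real.goldenRatio_irrational.intCast_mul (sub_ne_zero.2 hne)
    refine hirr ⟨((c - a : ℤ) : ℚ), ?_⟩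
    push_cast
    linarith
  subst hbd
  simpa using h

lemma evV_injective : Function.Injective evV := fun _ _ h =>
  funext fun i => evZ_injective (congrFun h i)

lemma evZ_dotZ (v w : Fin 3 → ℤ × ℤ) : evZ (dotZ v w) = evV v ⬝ᵥ evV w := by
  simp [dotZ, evZ_add, evZ_mulZ, dotProduct, Fin.sum_univ_three, evV]

lemma evV_neg (v : Fin 3 → ℤ × ℤ) : evV (-v) = -evV v := by
  ext i; simp [evV, evZ_neg]

lemma evV_reflZ {v x : Fin 3 → ℤ × ℤ} (h : 2 ∣ (dotZ x v).1 ∧ 2 ∣ (dotZ x v).2) :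
    evV (reflZ v x) = reflV (evV v) (evV x) := by
  ext i
  simp only [evV, reflZ, evZ_sub, evZ_mulZ, evZ_halfZ h, evZ_dotZ, reflV, Pi.sub_apply,
    Pi.smul_apply, smul_eq_mul]

lemma posRoots_eq : posRoots = rootsZ.image evV := by
  simp only [posRoots, tau_inv, rootsZ, Finset.image_insert, Finset.image_singleton]
  congr! <;> ext i <;> fin_cases i <;> simp [evV, evZ] <;> ring

lemma icosahedron_eq : icosahedron = vertsZ.image evV := by
  simp only [icosahedron, vertsZ, Finset.image_insert, Finset.image_singleton]
  congr! <;> ext i <;> fin_cases i <;> simp [evV, evZ]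

lemma rootsZ_card : rootsZ.card = 15 := by decide +kernel

lemma dotZ_self_root : ∀ v ∈ rootsZ, dotZ v v = (4, 0) := by decide +kernel

lemma dotZ_self_vert : ∀ y ∈ vertsZ, dotZ y y = (2, 1) := by decide +kernel

/-- `halfZ` is integer division, so `reflZ` agrees with the reflection only where the products are
even. -/
lemma dotZ_vert_root_even :
    ∀ y ∈ vertsZ, ∀ v ∈ rootsZ, 2 ∣ (dotZ y v).1 ∧ 2 ∣ (dotZ y v).2 := by decide +kernel

lemma dotZ_root_root_even :
    ∀ y ∈ rootsZ, ∀ v ∈ rootsZ, 2 ∣ (dotZ y v).1 ∧ 2 ∣ (dotZ y v).2 := by decide +kernel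

lemma reflZ_vert : ∀ v ∈ rootsZ, ∀ y ∈ vertsZ, reflZ v y ∈ vertsZ := by decide +kernel

/-- The positive one of `v` and `-v`, for a root `v`. -/
def posZ (v : Fin 3 → ℤ × ℤ) : Fin 3 → ℤ × ℤ := if v ∈ rootsZ then v else -v

lemma image_posZ_reflZ : ∀ w ∈ rootsZ, rootsZ.image (fun v => posZ (reflZ w v)) = rootsZ := by
  decide +kernel

/-- Equal cardinalities turn the equality of sets into a bijection between the roots not orthogonal
to `y` and the vertices other than `±y`. -/
lemma image_reflZ_vert : ∀ y ∈ vertsZ,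
    (rootsZ.filter (fun v => dotZ y v ≠ 0)).image (fun v => reflZ v y) =
      (vertsZ.erase y).erase (-y) ∧
    ((vertsZ.erase y).erase (-y)).card = (rootsZ.filter (fun v => dotZ y v ≠ 0)).card := by
  decide +kernel

lemma neg_vertsZ : ∀ y ∈ vertsZ, -y ∈ vertsZ ∧ -y ≠ y := by decide +kernel

lemma exists_of_mem_posRoots {v : Fin 3 → ℝ} (hv : v ∈ posRoots) : ∃ w ∈ rootsZ, evV w = v := by
  simpa [posRoots_eq] using hv

lemma exists_of_mem_icosahedron {y : Fin 3 → ℝ} (hy : y ∈ icosahedron) :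
    ∃ w ∈ vertsZ, evV w = y := by
  simpa [icosahedron_eq] using hy

lemma card_posRoots : posRoots.card = 15 := by
  rw [posRoots_eq, Finset.card_image_of_injective _ evV_injective, rootsZ_card]

lemma dotProduct_self_posRoots {v : Fin 3 → ℝ} (hv : v ∈ posRoots) : v ⬝ᵥ v = 4 := by
  obtain ⟨w, hw, rfl⟩ := exists_of_mem_posRoots hv
  rw [← evZ_dotZ, dotZ_self_root w hw]
  simp [evZ]

lemma dotProduct_self_icosahedron {y : Fin 3 → ℝ} (hy : y ∈ icosahedron) : y ⬝ᵥ y = τ + 2 := by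
  obtain ⟨w, hw, rfl⟩ := exists_of_mem_icosahedron hy
  rw [← evZ_dotZ, dotZ_self_vert w hw]
  simp only [evZ]
  push_cast
  ring

lemma reflV_mem_icosahedron {v y : Fin 3 → ℝ} (hv : v ∈ posRoots) (hy : y ∈ icosahedron) :
    reflV v y ∈ icosahedron := by
  obtain ⟨w, hw, rfl⟩ := exists_of_mem_posRoots hv
  obtain ⟨z, hz, rfl⟩ := exists_of_mem_icosahedron hy
  rw [← evV_reflZ (dotZ_vert_root_even z hz w hw), icosahedron_eq]
  exact Finset.mem_image_of_mem _ (reflZ_vert w hw z hz)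

lemma reflV_reflV {v : Fin 3 → ℝ} (hv : v ⬝ᵥ v = 4) (x : Fin 3 → ℝ) :
    reflV v (reflV v x) = x := by
  ext i
  simp only [reflV, sub_dotProduct, smul_dotProduct, hv, Pi.sub_apply, Pi.smul_apply, smul_eq_mul]
  ring

lemma reflV_dotProduct (v x y : Fin 3 → ℝ) : reflV v x ⬝ᵥ y = x ⬝ᵥ reflV v y := by
  simp only [reflV, sub_dotProduct, smul_dotProduct, dotProduct_sub, dotProduct_smul, smul_eq_mul,
    dotProduct_comm v y]
  ring

lemma prod_icosahedron_reflV {M : Type*} [CommMonoid M] {v : Fin 3 → ℝ} (hv : v ∈ posRoots)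
    (f : (Fin 3 → ℝ) → M) : ∏ y ∈ icosahedron, f (reflV v y) = ∏ y ∈ icosahedron, f y :=
  Finset.prod_nbij' (reflV v) (reflV v) (fun _ h => reflV_mem_icosahedron hv h)
    (fun _ h => reflV_mem_icosahedron hv h)
    (fun y _ => reflV_reflV (dotProduct_self_posRoots hv) y)
    (fun y _ => reflV_reflV (dotProduct_self_posRoots hv) y) (fun _ _ => rfl)

/-- A reflection permutes the positive roots up to sign. -/
lemma prod_posRoots_reflV {M : Type*} [CommMonoid M] {w : Fin 3 → ℝ} (hw : w ∈ posRoots)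
    {f : (Fin 3 → ℝ) → M} (hf : ∀ v, f (-v) = f v) :
    ∏ v ∈ posRoots, f (reflV w v) = ∏ v ∈ posRoots, f v := by
  obtain ⟨w, hwZ, rfl⟩ := exists_of_mem_posRoots hw
  simp only [posRoots_eq, Finset.prod_image evV_injective.injOn]
  have himg := image_posZ_reflZ w hwZ
  -- A map of a finite set onto itself is injective.
  have hinj : Set.InjOn (fun v => posZ (reflZ w v)) rootsZ :=
    Finset.card_image_iff.1 (by rw [himg])
  conv_rhs => rw [← himg, Finset.prod_image hinj]
  refine Finset.prod_congr rfl fun v hv => ?_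
  rw [← evV_reflZ (dotZ_root_root_even v hv w hwZ), posZ]
  split_ifs
  · rfl
  · rw [evV_neg, hf]

lemma neg_mem_icosahedron {y : Fin 3 → ℝ} (hy : y ∈ icosahedron) : -y ∈ icosahedron := by
  obtain ⟨z, hz, rfl⟩ := exists_of_mem_icosahedron hy
  rw [← evV_neg, icosahedron_eq]
  exact Finset.mem_image_of_mem _ (neg_vertsZ z hz).1

/-- The positive roots not orthogonal to a vertex `y` carry it to each vertex other than `±y`
exactly once. -/
lemma sum_posRoots_reflV {M : Type*} [AddCommGroup M] [Module ℝ M] {y : Fin 3 → ℝ}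
    (hy : y ∈ icosahedron) (f : (Fin 3 → ℝ) → M) (i : Fin 3) :
    ∑ v ∈ posRoots, (y ⬝ᵥ v / 2 * v i) • f (reflV v y) =
      ∑ z ∈ icosahedron, (y i - z i) • f z - (2 * y i) • f (-y) := by
  obtain ⟨y, hyZ, rfl⟩ := exists_of_mem_icosahedron hy
  obtain ⟨himg, hcard⟩ := image_reflZ_vert y hyZ
  have hinj : Set.InjOn (fun v => reflZ v y) (rootsZ.filter (fun v => dotZ y v ≠ 0)) :=
    Finset.card_image_iff.1 (by rw [himg, hcard])
  simp only [posRoots_eq, icosahedron_eq, Finset.sum_image evV_injective.injOn]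
  -- The coefficient is a coordinate of `y - reflV v y`, which vanishes for roots orthogonal to `y`.
  have hl : ∑ v ∈ rootsZ, (evV y ⬝ᵥ evV v / 2 * evV v i) • f (reflV (evV v) (evV y)) =
      ∑ v ∈ rootsZ.filter (fun v => dotZ y v ≠ 0),
        (evV y i - evV (reflZ v y) i) • f (evV (reflZ v y)) := by
    rw [Finset.sum_filter]
    refine Finset.sum_congr rfl fun v hv => ?_
    rw [evV_reflZ (dotZ_vert_root_even y hyZ v hv)]
    split_ifs with h
    · congr 1
      simp [reflV]
    · rw [not_not] at h
      rw [← evZ_dotZ, h]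
      simp [evZ]
  -- In the full sum over vertices the term at `y` is zero and the term at `-y` is the one
  -- subtracted.
  rw [hl, ← Finset.sum_image (f := fun z => (evV y i - evV z i) • f (evV z)) hinj, himg,
    ← Finset.add_sum_erase vertsZ _ hyZ, ← Finset.add_sum_erase (vertsZ.erase y) _
      (Finset.mem_erase.2 ⟨(neg_vertsZ y hyZ).2, (neg_vertsZ y hyZ).1⟩), evV_neg]
  simp only [Pi.neg_apply, sub_self, zero_smul, sub_neg_eq_add, ← two_mul]
  abel

/-! ### Reflections and divided differences of polynomials. -/

open MvPolynomial

/-- The action `p ↦ p ∘ reflV v` of a reflection on polynomials. -/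
noncomputable def refl (v : Fin 3 → ℝ) : Poly →ₐ[ℝ] Poly :=
  aeval fun i => X i - C (v i / 2) * lin v

lemma refl_X (v : Fin 3 → ℝ) (i : Fin 3) : refl v (X i) = X i - C (v i / 2) * lin v := by
  simp [refl]

lemma eval_lin (x y : Fin 3 → ℝ) : eval x (lin y) = x ⬝ᵥ y := by
  simp [lin, dotProduct, mul_comm]

lemma eval_refl (v x : Fin 3 → ℝ) (p : Poly) : eval x (refl v p) = eval (reflV v x) p := by
  induction p using MvPolynomial.induction_on with
  | C a => simp [refl]
  | add p r hp hr => simp [hp, hr]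
  | mul_X p i hp =>
    have : reflV v x i = x i - x ⬝ᵥ v / 2 * v i := rfl
    simp only [map_mul, map_sub, eval_X, eval_C, hp, refl_X, eval_lin, this]
    ring

lemma lin_sub (y z : Fin 3 → ℝ) : lin (y - z) = lin y - lin z := by
  simp [lin, sub_mul, Finset.sum_sub_distrib]

lemma lin_smul (a : ℝ) (y : Fin 3 → ℝ) : lin (a • y) = C a * lin y := by
  simp [lin, Finset.mul_sum, mul_assoc]

lemma lin_neg (y : Fin 3 → ℝ) : lin (-y) = -lin y := by
  simp [lin]

lemma refl_lin (v y : Fin 3 → ℝ) : refl v (lin y) = lin (reflV v y) := by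
  apply MvPolynomial.funext
  intro x
  rw [eval_refl, eval_lin, eval_lin, reflV_dotProduct]

lemma eval_normSq (x : Fin 3 → ℝ) : eval x normSq = x ⬝ᵥ x := by
  simp [normSq, dotProduct, sq]

lemma refl_normSq {v : Fin 3 → ℝ} (hv : v ⬝ᵥ v = 4) : refl v normSq = normSq := by
  apply MvPolynomial.funext
  intro x
  rw [eval_refl, eval_normSq, eval_normSq, reflV_dotProduct, reflV_reflV hv]

lemma refl_refl {v : Fin 3 → ℝ} (hv : v ⬝ᵥ v = 4) (p : Poly) : refl v (refl v p) = p := by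
  apply MvPolynomial.funext
  intro x
  rw [eval_refl, eval_refl, reflV_reflV hv]

lemma lin_ne_zero {v : Fin 3 → ℝ} (hv : v ⬝ᵥ v = 4) : lin v ≠ 0 := by
  intro h
  have := eval_lin v v
  rw [h, hv] at this
  norm_num at this

/-- The two polynomials agree on the mirror of `v`. The induction is a twisted Leibniz rule, since a
variable minus its reflection is a multiple of `lin v`. -/
lemma lin_dvd_sub_refl (v : Fin 3 → ℝ) (p : Poly) : lin v ∣ p - refl v p := by
  induction p using MvPolynomial.induction_on with
  | C a => simp [refl]
  | add p r hp hr =>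
    rw [map_add, add_sub_add_comm]
    exact dvd_add hp hr
  | mul_X p i hp =>
    have : p * X i - refl v (p * X i) =
        (p - refl v p) * X i + refl v p * (C (v i / 2) * lin v) := by
      rw [map_mul, refl_X]; ring
    rw [this]
    exact dvd_add (hp.mul_right _) (((dvd_refl _).mul_left _).mul_left _)

/-- The divided difference `(p - p ∘ reflV v) / ⟨x, v⟩`. -/
noncomputable def divDiff (v : Fin 3 → ℝ) (p : Poly) : Poly := (lin_dvd_sub_refl v p).choose

lemma lin_mul_divDiff (v : Fin 3 → ℝ) (p : Poly) : lin v * divDiff v p = p - refl v p :=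
  (lin_dvd_sub_refl v p).choose_spec.symm

lemma divDiff_unique {v : Fin 3 → ℝ} (hv : v ⬝ᵥ v = 4) {p d : Poly}
    (h : lin v * d = p - refl v p) : divDiff v p = d :=
  mul_left_cancel₀ (lin_ne_zero hv) ((lin_mul_divDiff v p).trans h.symm)

lemma divDiff_add {v : Fin 3 → ℝ} (hv : v ⬝ᵥ v = 4) (p r : Poly) :
    divDiff v (p + r) = divDiff v p + divDiff v r :=
  divDiff_unique hv (by rw [mul_add, lin_mul_divDiff, lin_mul_divDiff, map_add]; ring)

lemma divDiff_mul {v : Fin 3 → ℝ} (hv : v ⬝ᵥ v = 4) {a : Poly} (ha : refl v a = a) (p : Poly) :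
    divDiff v (a * p) = a * divDiff v p :=
  divDiff_unique hv (by rw [mul_left_comm, lin_mul_divDiff, map_mul, ha]; ring)

lemma refl_C (v : Fin 3 → ℝ) (a : ℝ) : refl v (C a) = C a := by simp [refl]

lemma divDiff_X_mul {v : Fin 3 → ℝ} (hv : v ⬝ᵥ v = 4) (i : Fin 3) (p : Poly) :
    divDiff v (X i * p) = X i * divDiff v p + C (v i / 2) * refl v p := by
  refine divDiff_unique hv ?_
  rw [map_mul, refl_X]
  linear_combination X i * lin_mul_divDiff v p

lemma isHomogeneous_lin (y : Fin 3 → ℝ) : (lin y).IsHomogeneous 1 :=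
  IsHomogeneous.sum _ _ _ fun i _ => isHomogeneous_C_mul_X _ i

lemma isHomogeneous_normSq : normSq.IsHomogeneous 2 :=
  IsHomogeneous.sum _ _ _ fun i _ => isHomogeneous_X_pow i 2

lemma isHomogeneous_refl (v : Fin 3 → ℝ) {p : Poly} {n : ℕ} (hp : p.IsHomogeneous n) :
    (refl v p).IsHomogeneous n := by
  have := hp.aeval (fun i => X i - C (v i / 2) * lin v) (n := 1)
    fun i => (isHomogeneous_X ℝ i).sub ((isHomogeneous_lin v).C_mul _)
  simpa [refl] using this

/-- A factor of a homogeneous polynomial by a nonzero linear form is homogeneous. -/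
lemma isHomogeneous_of_lin_mul {v : Fin 3 → ℝ} (hv : v ⬝ᵥ v = 4) {d : Poly} {n : ℕ}
    (h : (lin v * d).IsHomogeneous n) : d.IsHomogeneous (n - 1) ∧ (n = 0 → d = 0) := by
  -- Multiplication by `lin v` shifts homogeneous components by one degree, and it is injective.
  have key : ∀ k, k + 1 ≠ n → homogeneousComponent k d = 0 := by
    intro k hk
    have h1 : homogeneousComponent (k + 1) (lin v * d) = lin v * homogeneousComponent k d := by
      conv_lhs => rw [← sum_homogeneousComponent d, Finset.mul_sum, map_sum]
      have : ∀ j, homogeneousComponent (k + 1) (lin v * homogeneousComponent j d) =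
          if j = k then lin v * homogeneousComponent k d else 0 := by
        intro j
        rw [homogeneousComponent_of_mem
          ((isHomogeneous_lin v).mul (homogeneousComponent_isHomogeneous j d))]
        by_cases hj : j = k
        · subst hj; simp [add_comm]
        · rw [if_neg (by omega), if_neg hj]
      simp only [this, Finset.sum_ite_eq', Finset.mem_range]
      split_ifs with hlt
      · rfl
      · rw [homogeneousComponent_eq_zero _ _ (by omega), mul_zero]
    rw [homogeneousComponent_of_mem h, if_neg hk] at h1
    exact (mul_eq_zero.1 h1.symm).resolve_left (lin_ne_zero hv)
  constructor
  · by_cases hn : n = 0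
    · have : d = 0 := by
        rw [← sum_homogeneousComponent d]
        exact Finset.sum_eq_zero fun k _ => key k (by omega)
      rw [this]; exact isHomogeneous_zero _ _ _
    · rw [← sum_homogeneousComponent d]
      refine IsHomogeneous.sum _ _ _ fun k _ => ?_
      by_cases hk : k + 1 = n
      · subst hk; exact homogeneousComponent_isHomogeneous _ _
      · rw [key k hk]; exact isHomogeneous_zero _ _ _
  · intro hn
    rw [← sum_homogeneousComponent d]
    exact Finset.sum_eq_zero fun k _ => key k (by omega)

lemma isHomogeneous_divDiff {v : Fin 3 → ℝ} (hv : v ⬝ᵥ v = 4) {p : Poly} {n : ℕ}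
    (hp : p.IsHomogeneous n) :
    (divDiff v p).IsHomogeneous (n - 1) ∧ (n = 0 → divDiff v p = 0) :=
  isHomogeneous_of_lin_mul hv (by
    rw [lin_mul_divDiff]; exact hp.sub (isHomogeneous_refl v hp))

/-! ### Dunkl operators and the Dunkl Laplacian. -/

/-- The Dunkl operator of type `H₃` with parameter `κ` in the `i`-th coordinate direction. -/
noncomputable def dunkl (κ : ℝ) (i : Fin 3) : Poly →ₗ[ℝ] Poly where
  toFun p := pderiv i p + C κ * ∑ v ∈ posRoots, C (v i) * divDiff v p
  map_add' p r := by
    rw [Finset.sum_congr rfl fun v hv => by rw [divDiff_add (dotProduct_self_posRoots hv)]]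
    simp only [map_add, mul_add, Finset.sum_add_distrib]
    ring
  map_smul' a p := by
    simp only [smul_eq_C_mul, RingHom.id_apply]
    rw [Finset.sum_congr rfl fun v hv => by
      rw [divDiff_mul (dotProduct_self_posRoots hv) (refl_C v a), mul_left_comm]]
    rw [← Finset.mul_sum, pderiv_C_mul]
    ring

lemma dunkl_apply (κ : ℝ) (i : Fin 3) (p : Poly) :
    dunkl κ i p = pderiv i p + C κ * ∑ v ∈ posRoots, C (v i) * divDiff v p := rfl

lemma dunkl_C_mul (κ : ℝ) (i : Fin 3) (a : ℝ) (p : Poly) :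
    dunkl κ i (C a * p) = C a * dunkl κ i p := by
  rw [← smul_eq_C_mul, map_smul, smul_eq_C_mul]

lemma isHomogeneous_dunkl (κ : ℝ) (i : Fin 3) {p : Poly} {n : ℕ} (hp : p.IsHomogeneous n) :
    (dunkl κ i p).IsHomogeneous (n - 1) :=
  hp.pderiv.add ((IsHomogeneous.sum _ _ _ fun _ hv =>
    ((isHomogeneous_divDiff (dotProduct_self_posRoots hv) hp).1.C_mul _)).C_mul _)

lemma dunkl_eq_zero (κ : ℝ) (i : Fin 3) {p : Poly} (hp : p.IsHomogeneous 0) :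
    dunkl κ i p = 0 := by
  rw [dunkl_apply, Finset.sum_eq_zero fun v hv => by
    rw [(isHomogeneous_divDiff (dotProduct_self_posRoots hv) hp).2 rfl, mul_zero]]
  rw [totalDegree_eq_zero_iff_eq_C.1 ((totalDegree_zero_iff_isHomogeneous _).2 hp)]
  simp

/-- `|x|²` is reflection-invariant, so it passes through the divided differences and only the
derivative sees it. -/
lemma dunkl_normSq_mul (κ : ℝ) (i : Fin 3) (p : Poly) :
    dunkl κ i (normSq * p) = normSq * dunkl κ i p + 2 * X i * p := by
  have h : pderiv i normSq = 2 * X i := by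
    simp [normSq, Derivation.leibniz_pow, pderiv_X, Pi.single_apply]
  rw [dunkl_apply, dunkl_apply, Derivation.leibniz, h, Finset.sum_congr rfl fun v hv => by
    rw [divDiff_mul (dotProduct_self_posRoots hv) (refl_normSq (dotProduct_self_posRoots hv)),
      mul_left_comm], ← Finset.mul_sum]
  simp only [smul_eq_mul]
  ring

lemma sum_C_mul_X_mul (v : Fin 3 → ℝ) (p : Poly) : ∑ i, C (v i) * (X i * p) = lin v * p := by
  simp only [lin, Finset.sum_mul, mul_assoc]

/-- Contraction with `X i` turns `∑ v_i x_i` into `⟨x,v⟩`, which clears the denominators; the rest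
is Euler's identity. -/
lemma sum_X_mul_dunkl (κ : ℝ) {p : Poly} {n : ℕ} (hp : p.IsHomogeneous n) :
    ∑ i, X i * dunkl κ i p = C (n : ℝ) * p + C κ * ∑ v ∈ posRoots, (p - refl v p) := by
  have : ∀ i : Fin 3, X i * dunkl κ i p = X i * pderiv i p +
      C κ * ∑ v ∈ posRoots, C (v i) * (X i * divDiff v p) := by
    intro i
    rw [dunkl_apply, mul_add, mul_left_comm, Finset.mul_sum]
    simp only [mul_left_comm (X i)]
  simp only [this, Finset.sum_add_distrib, hp.sum_X_mul_pderiv, ← Finset.mul_sum]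
  rw [Finset.sum_comm]
  simp only [sum_C_mul_X_mul, lin_mul_divDiff]
  simp

lemma sum_dunkl_X_mul (κ : ℝ) (p : Poly) :
    ∑ i, dunkl κ i (X i * p) =
      ∑ i, X i * dunkl κ i p + 3 * p + C (2 * κ) * ∑ v ∈ posRoots, refl v p := by
  have h : ∀ i : Fin 3, dunkl κ i (X i * p) = X i * dunkl κ i p + p +
      C κ * ∑ v ∈ posRoots, C (v i * v i / 2) * refl v p := by
    intro i
    rw [dunkl_apply, dunkl_apply, Derivation.leibniz, pderiv_X_self,
      Finset.sum_congr rfl fun v hv => by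
        rw [divDiff_X_mul (dotProduct_self_posRoots hv), mul_add, mul_left_comm, ← mul_assoc (C _),
          ← C_mul, ← mul_div_assoc],
      Finset.sum_add_distrib, ← Finset.mul_sum]
    simp only [smul_eq_mul]
    ring
  -- The factor 2 is `|v|² / 2`.
  have h2 : ∑ i : Fin 3, ∑ v ∈ posRoots, C (v i * v i / 2) * refl v p =
      C 2 * ∑ v ∈ posRoots, refl v p := by
    rw [Finset.sum_comm, Finset.mul_sum]
    refine Finset.sum_congr rfl fun v hv => ?_
    rw [← Finset.sum_mul, ← map_sum, ← Finset.sum_div]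
    have := dotProduct_self_posRoots hv
    rw [dotProduct] at this
    rw [this]
    norm_num
  simp only [h, Finset.sum_add_distrib, ← Finset.mul_sum, h2]
  simp only [Finset.sum_const, Finset.card_univ, Fintype.card_fin, nsmul_eq_mul, map_mul]
  push_cast
  ring

/-- The Dunkl Laplacian of type `H₃`. -/
noncomputable def dunklLap (κ : ℝ) : Poly →ₗ[ℝ] Poly := ∑ i, dunkl κ i ∘ₗ dunkl κ i

lemma dunklLap_apply (κ : ℝ) (p : Poly) : dunklLap κ p = ∑ i, dunkl κ i (dunkl κ i p) := by
  simp [dunklLap]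

lemma dunklLap_C_mul (κ : ℝ) (a : ℝ) (p : Poly) :
    dunklLap κ (C a * p) = C a * dunklLap κ p := by
  rw [← smul_eq_C_mul, map_smul, smul_eq_C_mul]

lemma isHomogeneous_dunklLap (κ : ℝ) {p : Poly} {n : ℕ} (hp : p.IsHomogeneous n) :
    (dunklLap κ p).IsHomogeneous (n - 2) := by
  rw [dunklLap_apply]
  exact IsHomogeneous.sum _ _ _ fun i _ => isHomogeneous_dunkl κ i (isHomogeneous_dunkl κ i hp)

lemma dunklLap_eq_zero (κ : ℝ) {p : Poly} {n : ℕ} (hp : p.IsHomogeneous n) (hn : n < 2) :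
    dunklLap κ p = 0 := by
  rw [dunklLap_apply]
  refine Finset.sum_eq_zero fun i _ => dunkl_eq_zero κ i ?_
  have := isHomogeneous_dunkl κ i hp
  rwa [Nat.sub_eq_zero_of_le (by omega)] at this

/-- The reflected copies of `p` coming from `∑ x_i T_i` and `∑ T_i x_i` cancel; the fifteen roots
leave the scalar `30κ`. -/
lemma dunklLap_normSq_mul (κ : ℝ) {p : Poly} {n : ℕ} (hp : p.IsHomogeneous n) :
    dunklLap κ (normSq * p) =
      normSq * dunklLap κ p + C (2 * (2 * n + 3 + 30 * κ)) * p := by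
  have h : ∀ i : Fin 3, dunkl κ i (dunkl κ i (normSq * p)) =
      normSq * dunkl κ i (dunkl κ i p) + (2 * (X i * dunkl κ i p) + 2 * dunkl κ i (X i * p)) := by
    intro i
    rw [dunkl_normSq_mul, map_add, dunkl_normSq_mul,
      show (2 : Poly) * X i * p = C 2 * (X i * p) by rw [mul_assoc]; rfl, dunkl_C_mul,
      show (C 2 : Poly) = 2 from rfl]
    ring
  simp only [dunklLap_apply, h, Finset.sum_add_distrib, ← Finset.mul_sum]
  rw [sum_dunkl_X_mul, sum_X_mul_dunkl κ hp, Finset.sum_sub_distrib]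
  simp only [Finset.sum_const, card_posRoots, nsmul_eq_mul, map_mul, map_add,
    show (C 2 : Poly) = 2 from rfl, show (C 3 : Poly) = 3 from rfl, show (C 30 : Poly) = 30 from rfl]
  push_cast
  ring

lemma dunklLap_normSq_pow_mul (κ : ℝ) {p : Poly} {n : ℕ} (hp : p.IsHomogeneous n) (j : ℕ) :
    dunklLap κ (normSq ^ (j + 1) * p) = normSq ^ (j + 1) * dunklLap κ p +
      C (2 * (j + 1) * (2 * n + 2 * j + 3 + 30 * κ)) * (normSq ^ j * p) := by
  induction j with
  | zero =>
    rw [zero_add, pow_one, dunklLap_normSq_mul κ hp]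
    simp
  | succ j ih =>
    rw [pow_succ', mul_assoc,
      dunklLap_normSq_mul κ ((isHomogeneous_normSq.pow (j + 1)).mul hp), ih]
    push_cast
    simp only [map_mul, map_add]
    simp only [show (C 2 : Poly) = 2 from rfl, show (C 3 : Poly) = 3 from rfl,
      show (C 30 : Poly) = 30 from rfl, map_one]
    ring

/-! ### Logarithmic derivatives of the generating function. -/

/-- A real number as a constant power series with polynomial coefficients. -/
noncomputable def constR (a : ℝ) : PowerSeries Poly := PowerSeries.C (C a)

lemma smul_eq_constR_mul (a : ℝ) (F : PowerSeries Poly) : a • F = constR a * F := by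
  ext1 n
  rw [constR, PowerSeries.coeff_C_mul, ← smul_eq_C_mul]
  rfl

lemma constR_add (a b : ℝ) : constR (a + b) = constR a + constR b := by simp [constR]

lemma constR_sub (a b : ℝ) : constR (a - b) = constR a - constR b := by simp [constR]

lemma constR_mul (a b : ℝ) : constR (a * b) = constR a * constR b := by simp [constR]

lemma constR_neg (a : ℝ) : constR (-a) = -constR a := by simp [constR]

lemma constR_one : constR 1 = 1 := by simp [constR]

lemma coeff_constR_mul (a : ℝ) (F : PowerSeries Poly) (n : ℕ) :
    PowerSeries.coeff n (constR a * F) = C a * PowerSeries.coeff n F := by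
  rw [constR, PowerSeries.coeff_C_mul]

lemma coeff_oneSubPow (y : Fin 3 → ℝ) (a : ℝ) (n : ℕ) :
    PowerSeries.coeff n (oneSubPow y a) = (-lin y) ^ n * C (Ring.choose a n) := by
  rw [oneSubPow, PowerSeries.coeff_rescale, PowerSeries.binomialSeries_coeff, smul_eq_C_mul,
    mul_one]

lemma succ_mul_choose_succ (a : ℝ) (n : ℕ) :
    (n + 1 : ℝ) * Ring.choose a (n + 1) = (a - n) * Ring.choose a n := by
  have := Ring.choose_smul_choose a (n := n + 1) (k := n) (by omega)
  simp only [Nat.choose_succ_self_right, nsmul_eq_mul, add_tsub_cancel_left,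
    Ring.choose_one_right] at this
  push_cast at this
  linarith

/-- The linear power series `1 - r ⟨x, y⟩`. -/
noncomputable def oneSub (y : Fin 3 → ℝ) : PowerSeries Poly :=
  1 - PowerSeries.C (lin y) * PowerSeries.X

lemma oneSub_mul_oneSubPow_neg_one (y : Fin 3 → ℝ) : oneSub y * oneSubPow y (-1) = 1 := by
  have h1 : oneSub y = oneSubPow y 1 := by
    have := PowerSeries.binomialSeries_nat (R := ℝ) (A := Poly) 1
    rw [oneSubPow]
    push_cast at this
    rw [this]
    simp [oneSub, PowerSeries.rescale_X, sub_eq_add_neg]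
  rw [h1, oneSubPow, oneSubPow, ← map_mul, ← PowerSeries.binomialSeries_add]
  simp

/-- The series `∑ (n + 1) binom(a, n + 1) (-⟨x, y⟩)^n r^n`, the derivative of the binomial series
of exponent `a` at `-r ⟨x, y⟩`. -/
noncomputable def binomDeriv (y : Fin 3 → ℝ) (a : ℝ) : PowerSeries Poly :=
  PowerSeries.mk fun n => (-lin y) ^ n * C ((n + 1 : ℝ) * Ring.choose a (n + 1))

/-- The differential equation `(1 + s) B'(s) = a B(s)` of the binomial series, at `s = -r⟨x,y⟩`. -/
lemma oneSub_mul_binomDeriv (y : Fin 3 → ℝ) (a : ℝ) :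
    oneSub y * binomDeriv y a = constR a * oneSubPow y a := by
  ext1 n
  rw [oneSub, sub_mul, one_mul, map_sub, mul_assoc, PowerSeries.coeff_C_mul, coeff_constR_mul,
    coeff_oneSubPow]
  cases n with
  | zero => simp [binomDeriv]
  | succ n =>
    rw [PowerSeries.coeff_succ_X_mul, binomDeriv, PowerSeries.coeff_mk, PowerSeries.coeff_mk]
    have h := congrArg (C (σ := Fin 3)) (succ_mul_choose_succ a (n + 1))
    push_cast at h ⊢
    rw [h, C_mul, C_mul, C_sub, C_add]
    simp only [map_one]
    ring

lemma binomDeriv_eq (y : Fin 3 → ℝ) (a : ℝ) :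
    binomDeriv y a = constR a * oneSubPow y (-1) * oneSubPow y a := by
  have := congrArg (oneSubPow y (-1) * ·) (oneSub_mul_binomDeriv y a)
  simp only [← mul_assoc, mul_comm (oneSubPow y (-1)) (oneSub y), oneSub_mul_oneSubPow_neg_one,
    one_mul] at this
  rw [this]; ring

/-- The coefficientwise partial derivative. -/
noncomputable def dX (i : Fin 3) (F : PowerSeries Poly) : PowerSeries Poly :=
  PowerSeries.mk fun n => pderiv i (PowerSeries.coeff n F)

lemma dX_mul (i : Fin 3) (F G : PowerSeries Poly) : dX i (F * G) = F * dX i G + dX i F * G := by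
  ext1 n
  simp only [dX, map_add, PowerSeries.coeff_mul, PowerSeries.coeff_mk, map_sum,
    Derivation.leibniz, smul_eq_mul, Finset.sum_add_distrib]
  congr 1
  exact Finset.sum_congr rfl fun _ _ => mul_comm _ _

/-- The Euler operator `r d/dr`. -/
noncomputable def eulerR (F : PowerSeries Poly) : PowerSeries Poly :=
  PowerSeries.X * PowerSeries.derivative Poly F

lemma eulerR_mul (F G : PowerSeries Poly) :
    eulerR (F * G) = F * eulerR G + eulerR F * G := by
  rw [eulerR, Derivation.leibniz, eulerR, eulerR]
  simp only [smul_eq_mul]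
  ring

lemma pderiv_lin (i : Fin 3) (y : Fin 3 → ℝ) : pderiv i (lin y) = C (y i) := by
  simp [lin, pderiv_X, Pi.single_apply]

lemma dX_oneSubPow (i : Fin 3) (y : Fin 3 → ℝ) (a : ℝ) :
    dX i (oneSubPow y a) =
      (constR (-a) * (constR (y i) * PowerSeries.X * oneSubPow y (-1))) * oneSubPow y a := by
  have : dX i (oneSubPow y a) = constR (-y i) * (PowerSeries.X * binomDeriv y a) := by
    ext1 n
    rw [dX, PowerSeries.coeff_mk, coeff_oneSubPow, coeff_constR_mul]
    cases n with
    | zero => simp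
    | succ n =>
      rw [PowerSeries.coeff_succ_X_mul, binomDeriv, PowerSeries.coeff_mk, mul_comm, pderiv_C_mul,
        Derivation.leibniz_pow, map_neg, pderiv_lin]
      simp only [Nat.add_sub_cancel, smul_eq_mul, nsmul_eq_mul, C_mul, C_add, C_neg]
      push_cast
      simp only [map_one, map_natCast]
      ring
  rw [this, binomDeriv_eq, constR_neg, constR_neg]
  ring

lemma eulerR_oneSubPow (y : Fin 3 → ℝ) (a : ℝ) :
    eulerR (oneSubPow y a) =
      (constR (-a) * (oneSubPow y (-1) - 1)) * oneSubPow y a := by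
  have : eulerR (oneSubPow y a) =
      -PowerSeries.C (lin y) * (PowerSeries.X * binomDeriv y a) := by
    ext1 n
    rw [eulerR, neg_mul, map_neg, PowerSeries.coeff_C_mul]
    cases n with
    | zero => simp
    | succ n =>
      rw [PowerSeries.coeff_succ_X_mul, PowerSeries.coeff_succ_X_mul, binomDeriv,
        PowerSeries.coeff_mk, PowerSeries.coeff_derivative, coeff_oneSubPow]
      simp only [C_mul, C_add]
      simp only [map_one, map_natCast]
      ring
  have h := oneSub_mul_oneSubPow_neg_one y
  rw [oneSub] at h
  rw [this, binomDeriv_eq, constR_neg]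
  linear_combination constR a * oneSubPow y a * h

/-- The logarithmic derivative of a finite product. -/
lemma leibniz_prod {ι R : Type*} [CommRing R] {D : R → R}
    (hD : ∀ f g, D (f * g) = f * D g + D f * g) (s : Finset ι) {f g : ι → R}
    (hfg : ∀ y, D (f y) = g y * f y) : D (∏ y ∈ s, f y) = (∑ y ∈ s, g y) * ∏ y ∈ s, f y := by
  classical
  induction s using Finset.induction_on with
  | empty =>
    have := hD 1 1
    simp only [one_mul, mul_one] at this
    simpa using this
  | insert a s ha ih =>
    rw [Finset.prod_insert ha, Finset.sum_insert ha, hD, ih, hfg]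
    ring

/-- Used for both `∂_i` and `r d/dr`. The factor of exponent `-1` contributes `b y₀`, those of
exponent `-κ` contribute `κ b y`. -/
lemma leibniz_genFun {D : PowerSeries Poly → PowerSeries Poly}
    (hD : ∀ f g, D (f * g) = f * D g + D f * g) {b : (Fin 3 → ℝ) → PowerSeries Poly}
    (hb : ∀ y a, D (oneSubPow y a) = (constR (-a) * b y) * oneSubPow y a) (κ : ℝ)
    (y₀ : Fin 3 → ℝ) :
    D (genFun κ y₀) = (b y₀ + constR κ * ∑ y ∈ icosahedron, b y) * genFun κ y₀ := by
  rw [genFun, hD, leibniz_prod hD _ fun y => hb y (-κ), hb]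
  simp only [neg_neg, constR_one, ← Finset.mul_sum]
  ring

lemma map_refl_oneSubPow (v y : Fin 3 → ℝ) (a : ℝ) :
    PowerSeries.map (refl v : Poly →+* Poly) (oneSubPow y a) = oneSubPow (reflV v y) a := by
  ext1 n
  rw [PowerSeries.coeff_map, coeff_oneSubPow, coeff_oneSubPow]
  simp [refl_lin]

/-! ### Dunkl operators on the polynomials `q_n`. -/

/-- The invariant factor of the generating function. -/
noncomputable def invFun (κ : ℝ) : PowerSeries Poly := ∏ y ∈ icosahedron, oneSubPow y (-κ)

lemma genFun_eq (κ : ℝ) (y₀ : Fin 3 → ℝ) : genFun κ y₀ = oneSubPow y₀ (-1) * invFun κ := rfl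

lemma map_refl_genFun {v : Fin 3 → ℝ} (hv : v ∈ posRoots) (κ : ℝ) (y₀ : Fin 3 → ℝ) :
    PowerSeries.map (refl v : Poly →+* Poly) (genFun κ y₀) = genFun κ (reflV v y₀) := by
  rw [genFun, map_mul, map_prod, map_refl_oneSubPow]
  simp only [map_refl_oneSubPow]
  rw [prod_icosahedron_reflV hv fun y => oneSubPow y (-κ), genFun]

lemma refl_q {v : Fin 3 → ℝ} (hv : v ∈ posRoots) (κ : ℝ) (n : ℕ) (y₀ : Fin 3 → ℝ) :
    refl v (q κ n y₀) = q κ n (reflV v y₀) := by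
  rw [q, q, ← map_refl_genFun hv, PowerSeries.coeff_map]
  rfl

lemma oneSubPow_neg_one_sub (y z : Fin 3 → ℝ) :
    oneSubPow y (-1) - oneSubPow z (-1) =
      PowerSeries.C (lin (y - z)) * PowerSeries.X * oneSubPow y (-1) * oneSubPow z (-1) := by
  have hy := oneSub_mul_oneSubPow_neg_one y
  have hz := oneSub_mul_oneSubPow_neg_one z
  rw [oneSub] at hy hz
  rw [lin_sub, map_sub]
  linear_combination oneSubPow z (-1) * hy - oneSubPow y (-1) * hz

/-- Reflection changes only the factor at `y₀`. The resolvent identity `oneSubPow_neg_one_sub`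
produces the factor `lin v`, because `y₀ - reflV v y₀` is a multiple of `v`. -/
lemma divDiff_q {v : Fin 3 → ℝ} (hv : v ∈ posRoots) (κ : ℝ) (n : ℕ) (y₀ : Fin 3 → ℝ) :
    divDiff v (q κ n y₀) = PowerSeries.coeff n
      (constR (y₀ ⬝ᵥ v / 2) * PowerSeries.X * oneSubPow (reflV v y₀) (-1) * genFun κ y₀) := by
  refine divDiff_unique (dotProduct_self_posRoots hv) ?_
  rw [refl_q hv, q, q, ← map_sub, ← PowerSeries.coeff_C_mul]
  congr 1
  have h := oneSubPow_neg_one_sub y₀ (reflV v y₀)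
  rw [show y₀ - reflV v y₀ = (y₀ ⬝ᵥ v / 2) • v by simp [reflV], lin_smul, map_mul] at h
  rw [genFun_eq, genFun_eq, constR]
  linear_combination -invFun κ * h

lemma coeff_dX (i : Fin 3) (F : PowerSeries Poly) (n : ℕ) :
    PowerSeries.coeff n (dX i F) = pderiv i (PowerSeries.coeff n F) :=
  PowerSeries.coeff_mk _ _

lemma C_mul_divDiff_q (κ : ℝ) (i : Fin 3) {v : Fin 3 → ℝ} (hv : v ∈ posRoots) (y₀ : Fin 3 → ℝ)
    (n : ℕ) : C (v i) * divDiff v (q κ n y₀) = PowerSeries.coeff n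
      ((y₀ ⬝ᵥ v / 2 * v i) • oneSubPow (reflV v y₀) (-1) *
        (PowerSeries.X * genFun κ y₀)) := by
  rw [divDiff_q hv, ← coeff_constR_mul (v i),
    smul_eq_constR_mul (y₀ ⬝ᵥ v / 2 * v i) (oneSubPow (reflV v y₀) (-1)),
    constR_mul (y₀ ⬝ᵥ v / 2) (v i)]
  refine congrArg (PowerSeries.coeff n) ?_
  ring

lemma dunkl_q_eq_coeff (κ : ℝ) (i : Fin 3) (y₀ : Fin 3 → ℝ) (n : ℕ) :
    dunkl κ i (q κ n y₀) = PowerSeries.coeff n (dX i (genFun κ y₀) + constR κ *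
      ((∑ v ∈ posRoots, (y₀ ⬝ᵥ v / 2 * v i) • oneSubPow (reflV v y₀) (-1)) *
        (PowerSeries.X * genFun κ y₀))) := by
  have h : ∑ v ∈ posRoots, C (v i) * divDiff v (q κ n y₀) = PowerSeries.coeff n
      ((∑ v ∈ posRoots, (y₀ ⬝ᵥ v / 2 * v i) • oneSubPow (reflV v y₀) (-1)) *
        (PowerSeries.X * genFun κ y₀)) := by
    rw [Finset.sum_mul, map_sum (PowerSeries.coeff n)]
    exact Finset.sum_congr rfl fun v hv => C_mul_divDiff_q κ i hv y₀ n
  rw [map_add (PowerSeries.coeff n), coeff_constR_mul, coeff_dX, ← h, dunkl_apply]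
  rfl

/-- The derivative contributes `κ z_i (1 - r⟨x,z⟩)⁻¹` for each vertex `z`, the reflections `κ (y₀_i
- z_i)(1 - r⟨x,z⟩)⁻¹`. The `z_i` cancel, so everything is proportional to `y₀_i`. -/
lemma dunkl_genFun (κ : ℝ) (i : Fin 3) {y₀ : Fin 3 → ℝ} (hy₀ : y₀ ∈ icosahedron) (n : ℕ) :
    dunkl κ i (q κ n y₀) = PowerSeries.coeff n (constR (y₀ i) * (PowerSeries.X *
      ((oneSubPow y₀ (-1) + constR κ * ∑ y ∈ icosahedron, oneSubPow y (-1)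
        - constR (2 * κ) * oneSubPow (-y₀) (-1)) * genFun κ y₀))) := by
  rw [dunkl_q_eq_coeff, leibniz_genFun (dX_mul i) (fun y a => dX_oneSubPow i y a),
    sum_posRoots_reflV hy₀ fun y => oneSubPow y (-1)]
  congr 1
  have h1 : ∑ z ∈ icosahedron, (y₀ i - z i) • oneSubPow z (-1) =
      constR (y₀ i) * ∑ z ∈ icosahedron, oneSubPow z (-1) -
        ∑ z ∈ icosahedron, constR (z i) * oneSubPow z (-1) := by
    rw [Finset.mul_sum, ← Finset.sum_sub_distrib]
    refine Finset.sum_congr rfl fun z _ => ?_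
    rw [smul_eq_constR_mul, constR_sub, sub_mul]
  have h2 : ∑ z ∈ icosahedron, constR (z i) * PowerSeries.X * oneSubPow z (-1) =
      PowerSeries.X * ∑ z ∈ icosahedron, constR (z i) * oneSubPow z (-1) := by
    rw [Finset.mul_sum]
    exact Finset.sum_congr rfl fun z _ => by ring
  rw [h1, h2, smul_eq_constR_mul, constR_mul, constR_mul]
  ring

lemma rescale_neg_one_oneSubPow (y : Fin 3 → ℝ) (a : ℝ) :
    PowerSeries.rescale (-1 : Poly) (oneSubPow y a) = oneSubPow (-y) a := by
  ext1 n
  rw [PowerSeries.coeff_rescale, coeff_oneSubPow, coeff_oneSubPow, lin_neg, ← mul_assoc, ← mul_pow]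
  simp

lemma rescale_neg_one_invFun (κ : ℝ) : PowerSeries.rescale (-1 : Poly) (invFun κ) = invFun κ := by
  rw [invFun, map_prod]
  exact Finset.prod_nbij' (fun y => -y) (fun y => -y) (fun _ h => neg_mem_icosahedron h)
    (fun _ h => neg_mem_icosahedron h) (fun _ _ => neg_neg _) (fun _ _ => neg_neg _)
    (fun _ _ => rescale_neg_one_oneSubPow _ _)

/-- `F(r) (1 + r ⟨x, y₀⟩)⁻¹` is the even part of `F(r)`. -/
lemma coeff_oneSubPow_neg_mul_genFun (κ : ℝ) (y₀ : Fin 3 → ℝ) (n : ℕ) :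
    PowerSeries.coeff n (oneSubPow (-y₀) (-1) * genFun κ y₀) =
      if Even n then q κ n y₀ else 0 := by
  set P := oneSubPow (-y₀) (-1) * genFun κ y₀ with hP
  have hodd : ∀ k, Odd k → PowerSeries.coeff k P = 0 := by
    intro k hk
    -- `P` is `(1 - r²⟨x,y₀⟩²)⁻¹` times `invFun κ`, and both are even in `r`.
    have h1 : PowerSeries.rescale (-1 : Poly) P = P := by
      rw [hP, genFun_eq]
      simp only [map_mul, rescale_neg_one_oneSubPow, rescale_neg_one_invFun, neg_neg]
      ring
    have h2 := congrArg (PowerSeries.coeff k) h1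
    rw [PowerSeries.coeff_rescale, hk.neg_one_pow, neg_one_mul] at h2
    exact self_eq_neg.1 h2.symm
  split_ifs with hn
  -- `F = (1 + r⟨x,y₀⟩) P`, whose second part is odd.
  · have h1 : genFun κ y₀ = P + PowerSeries.C (lin y₀) * (PowerSeries.X * P) := by
      have := oneSub_mul_oneSubPow_neg_one (-y₀)
      rw [oneSub, lin_neg, map_neg] at this
      rw [hP]
      linear_combination -genFun κ y₀ * this
    rw [q, h1, map_add, PowerSeries.coeff_C_mul]
    cases n with
    | zero => simp
    | succ n =>
      rw [PowerSeries.coeff_succ_X_mul, hodd n (by simpa [Nat.even_add_one] using hn)]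
      simp
  · exact hodd n (Nat.not_even_iff_odd.1 hn)

lemma card_icosahedron : icosahedron.card = 12 := by
  rw [icosahedron_eq, Finset.card_image_of_injective _ evV_injective]
  decide +kernel

/-- The ratio `ν(n + 1) / ν(n)`. -/
noncomputable def nuRatio (κ : ℝ) (n : ℕ) : ℝ := n + 1 + 12 * κ - if Even n then 2 * κ else 0

/-- The series in `dunkl_genFun` is expressed by `r d/dr`, which gives `n`; the constant `1 + 12κ`
comes from `y₀` and the twelve vertices; the factor at `-y₀` gives `-2κ` times the even part, whence
the dependence on parity. -/
lemma dunkl_q_succ (κ : ℝ) (i : Fin 3) {y₀ : Fin 3 → ℝ} (hy₀ : y₀ ∈ icosahedron) (n : ℕ) :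
    dunkl κ i (q κ (n + 1) y₀) = C (nuRatio κ n * y₀ i) * q κ n y₀ := by
  have hE := leibniz_genFun eulerR_mul eulerR_oneSubPow κ y₀
  rw [Finset.sum_sub_distrib, Finset.sum_const, card_icosahedron] at hE
  have hE' : (oneSubPow y₀ (-1) + constR κ * ∑ y ∈ icosahedron, oneSubPow y (-1)
        - constR (2 * κ) * oneSubPow (-y₀) (-1)) * genFun κ y₀ = eulerR (genFun κ y₀) +
      constR (1 + 12 * κ) * genFun κ y₀ -
      constR (2 * κ) * (oneSubPow (-y₀) (-1) * genFun κ y₀) := by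
    rw [hE, constR_add, constR_mul 12 κ, constR_one, show constR 12 = 12 from map_ofNat (PowerSeries.C.comp C) 12]
    simp only [nsmul_eq_mul]
    push_cast
    ring
  have hX : PowerSeries.coeff n (eulerR (genFun κ y₀)) = C (n : ℝ) * q κ n y₀ := by
    rw [eulerR, q]
    cases n with
    | zero => simp
    | succ n =>
      rw [PowerSeries.coeff_succ_X_mul, PowerSeries.coeff_derivative]
      push_cast
      simp only [C_add, map_one, map_natCast]
      ring
  rw [dunkl_genFun κ i hy₀, coeff_constR_mul, PowerSeries.coeff_succ_X_mul, hE', map_sub, map_add,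
    hX, coeff_constR_mul, coeff_constR_mul, coeff_oneSubPow_neg_mul_genFun, nuRatio, ← q]
  split_ifs <;> simp only [C_mul, C_add, C_sub] <;> simp only [map_one, map_zero] <;> ring

lemma coeff_mul_isHomogeneous {F G : PowerSeries Poly}
    (hF : ∀ n, (PowerSeries.coeff n F).IsHomogeneous n)
    (hG : ∀ n, (PowerSeries.coeff n G).IsHomogeneous n) (n : ℕ) :
    (PowerSeries.coeff n (F * G)).IsHomogeneous n := by
  rw [PowerSeries.coeff_mul]
  refine IsHomogeneous.sum _ _ _ fun p hp => ?_
  rw [← Finset.HasAntidiagonal.mem_antidiagonal.1 hp]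
  exact (hF _).mul (hG _)

lemma isHomogeneous_coeff_oneSubPow (y : Fin 3 → ℝ) (a : ℝ) (n : ℕ) :
    (PowerSeries.coeff n (oneSubPow y a)).IsHomogeneous n := by
  rw [coeff_oneSubPow, mul_comm]
  simpa using ((isHomogeneous_lin y).neg.pow n).C_mul (Ring.choose a n)

lemma isHomogeneous_q (κ : ℝ) (n : ℕ) (y₀ : Fin 3 → ℝ) : (q κ n y₀).IsHomogeneous n := by
  refine coeff_mul_isHomogeneous (isHomogeneous_coeff_oneSubPow _ _) ?_ n
  refine Finset.prod_induction _
    (fun F : PowerSeries Poly => ∀ n, (PowerSeries.coeff n F).IsHomogeneous n)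
    (fun _ _ => coeff_mul_isHomogeneous) (fun n => ?_)
    fun y _ => isHomogeneous_coeff_oneSubPow y (-κ)
  rw [PowerSeries.coeff_one]
  split_ifs with h
  · rw [h]; exact isHomogeneous_one _ _
  · exact isHomogeneous_zero _ _ _

lemma q_zero (κ : ℝ) (y₀ : Fin 3 → ℝ) : q κ 0 y₀ = 1 := by
  rw [q, genFun, PowerSeries.coeff_zero_eq_constantCoeff_apply, map_mul, map_prod]
  simp [← PowerSeries.coeff_zero_eq_constantCoeff_apply, coeff_oneSubPow]

/-- From even `n` the second Pochhammer symbol gains a factor, from odd `n` the first. -/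
lemma nu_succ (κ : ℝ) (n : ℕ) : nu κ (n + 1) = nuRatio κ n * nu κ n := by
  have hp : ∀ a k, poch a (k + 1) = poch a k * (a + k) := by
    intro a k
    simp [poch, ascPochhammer_succ_right]
  rcases Nat.even_or_odd' n with ⟨m, rfl | rfl⟩
  · rw [nu, nu, nuRatio, if_pos (by simp), show (2 * m + 1) / 2 = m by omega,
      show (2 * m + 1 + 1) / 2 = m + 1 by omega, show 2 * m / 2 = m by omega, hp]
    push_cast
    ring
  · rw [nu, nu, nuRatio, if_neg (by simp), show (2 * m + 1) / 2 = m by omega,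
      show (2 * m + 1 + 1) / 2 = m + 1 by omega, show (2 * m + 1 + 1 + 1) / 2 = m + 1 by omega, hp]
    push_cast
    ring

lemma poch_pos {a : ℝ} (ha : 0 < a) (n : ℕ) : 0 < poch a n := ascPochhammer_pos n a ha

lemma nu_pos {κ : ℝ} (hκ : 0 ≤ κ) (n : ℕ) : 0 < nu κ n :=
  mul_pos (mul_pos (by positivity) (poch_pos (by positivity) _)) (poch_pos (by positivity) _)

/-! ### Kernel components and generalized Hermite polynomials. -/

/-- `ker κ n y` is `q_n(x; y) / ν(n)`, the homogeneous part of degree `n` of the Dunkl kernel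
at a vertex `y` of the icosahedron. -/
noncomputable def ker (κ : ℝ) (n : ℕ) (y : Fin 3 → ℝ) : Poly := C (nu κ n)⁻¹ * q κ n y

lemma C_nu_mul_ker {κ : ℝ} (hκ : 0 ≤ κ) (n : ℕ) (y : Fin 3 → ℝ) :
    C (nu κ n) * ker κ n y = q κ n y := by
  rw [ker, ← mul_assoc, ← C_mul, mul_inv_cancel₀ (nu_pos hκ n).ne', C_1, one_mul]

lemma ker_zero (κ : ℝ) (y : Fin 3 → ℝ) : ker κ 0 y = 1 := by
  simp [ker, q_zero, nu, poch]

lemma isHomogeneous_ker (κ : ℝ) (n : ℕ) (y : Fin 3 → ℝ) : (ker κ n y).IsHomogeneous n :=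
  (isHomogeneous_q κ n y).C_mul _

lemma refl_ker {v : Fin 3 → ℝ} (hv : v ∈ posRoots) (κ : ℝ) (n : ℕ) (y : Fin 3 → ℝ) :
    refl v (ker κ n y) = ker κ n (reflV v y) := by
  rw [ker, map_mul, refl_C, refl_q hv, ker]

lemma dunkl_ker_succ {κ : ℝ} (hκ : 0 ≤ κ) (i : Fin 3) {y : Fin 3 → ℝ} (hy : y ∈ icosahedron)
    (n : ℕ) : dunkl κ i (ker κ (n + 1) y) = C (y i) * ker κ n y := by
  have h0 := (nu_pos hκ n).ne'
  have h1 := (nu_pos hκ (n + 1)).ne'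
  rw [nu_succ] at h1
  have h2 := left_ne_zero_of_mul h1
  rw [ker, dunkl_C_mul, dunkl_q_succ κ i hy, ker, ← mul_assoc, ← mul_assoc, ← C_mul, ← C_mul,
    nu_succ]
  congr 2
  field_simp

lemma dunkl_ker_zero (κ : ℝ) (i : Fin 3) (y : Fin 3 → ℝ) : dunkl κ i (ker κ 0 y) = 0 :=
  dunkl_eq_zero κ i (isHomogeneous_ker κ 0 y)

lemma dunklLap_ker {κ : ℝ} (hκ : 0 ≤ κ) {y : Fin 3 → ℝ} (hy : y ∈ icosahedron) (n : ℕ) :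
    dunklLap κ (ker κ (n + 2) y) = C (τ + 2) * ker κ n y := by
  rw [dunklLap_apply, ← dotProduct_self_icosahedron hy, dotProduct, map_sum, Finset.sum_mul]
  refine Finset.sum_congr rfl fun i _ => ?_
  rw [dunkl_ker_succ hκ i hy, dunkl_C_mul, dunkl_ker_succ hκ i hy, ← mul_assoc, C_mul]

/-- The coefficients of `exp (-(τ + 2) s / (4 ω))`. -/
noncomputable def hermiteCoeff (ω : ℝ) (j : ℕ) : ℝ := (-((τ + 2) / (4 * ω))) ^ j / j.factorial

lemma hermiteCoeff_succ {ω : ℝ} (hω : 0 < ω) (j : ℕ) :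
    2 * ω * (2 * (j + 1)) * hermiteCoeff ω (j + 1) = -(hermiteCoeff ω j * (τ + 2)) := by
  have : (j.factorial : ℝ) ≠ 0 := by positivity
  rw [hermiteCoeff, hermiteCoeff, Nat.factorial_succ, pow_succ]
  push_cast
  field_simp
  ring

/-- The generalized Hermite polynomial `exp (-Δ / (4 ω))` applied to `ker κ n y`. -/
noncomputable def hermite (κ ω : ℝ) (n : ℕ) (y : Fin 3 → ℝ) : Poly :=
  ∑ j ∈ Finset.range (n + 1),
    if 2 * j ≤ n then C (hermiteCoeff ω j) * ker κ (n - 2 * j) y else 0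

lemma refl_hermite {v : Fin 3 → ℝ} (hv : v ∈ posRoots) (κ ω : ℝ) (n : ℕ) (y : Fin 3 → ℝ) :
    refl v (hermite κ ω n y) = hermite κ ω n (reflV v y) := by
  rw [hermite, map_sum, hermite]
  refine Finset.sum_congr rfl fun j _ => ?_
  split_ifs
  · rw [map_mul, refl_C, refl_ker hv]
  · exact map_zero _

lemma hermite_zero (κ ω : ℝ) (y : Fin 3 → ℝ) : hermite κ ω 0 y = 1 := by
  simp [hermite, hermiteCoeff, ker_zero]

/-- Summing up to `n` under a condition, rather than up to `n / 2`, makes the sums of degrees `n +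
1` and `n` correspond term by term. -/
lemma dunkl_hermite_succ {κ : ℝ} (hκ : 0 ≤ κ) (ω : ℝ) (i : Fin 3) {y : Fin 3 → ℝ}
    (hy : y ∈ icosahedron) (n : ℕ) :
    dunkl κ i (hermite κ ω (n + 1) y) = C (y i) * hermite κ ω n y := by
  rw [hermite, Finset.sum_range_succ, if_neg (by omega), add_zero, map_sum, hermite,
    Finset.mul_sum]
  refine Finset.sum_congr rfl fun j _ => ?_
  by_cases h : 2 * j ≤ n
  · rw [if_pos (by omega), if_pos h, dunkl_C_mul, show n + 1 - 2 * j = n - 2 * j + 1 by omega,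
      dunkl_ker_succ hκ i hy, mul_left_comm]
  · rw [if_neg h, mul_zero]
    split_ifs with h'
    -- Here `2 * j = n + 1`, and the term is a constant.
    · rw [dunkl_C_mul, show n + 1 - 2 * j = 0 by omega, dunkl_ker_zero, mul_zero]
    · exact map_zero _

/-- The sum `∑ (p - p ∘ σ)` over the reflections `σ` of the group `H₃`. -/
noncomputable def reflSum : Poly →ₗ[ℝ] Poly :=
  ∑ v ∈ posRoots, (LinearMap.id - (refl v).toLinearMap)

lemma reflSum_apply (p : Poly) : reflSum p = ∑ v ∈ posRoots, (p - refl v p) := by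
  simp [reflSum]

/-- The eigenvalue equation `(2 ω ⟨x, T⟩ - Δ) p = 2 ω (n + κ ∑ (1 - σ)) p` for the Dunkl
operators `T`, satisfied by harmonic and by generalized Hermite polynomials of degree `n`. -/
def HermiteEq (κ ω : ℝ) (n : ℕ) (p : Poly) : Prop :=
  C (2 * ω) * ∑ i, X i * dunkl κ i p - dunklLap κ p =
    C (2 * ω) * (C (n : ℝ) * p + C κ * reflSum p)

lemma hermiteEq_of_harmonic {κ ω : ℝ} {n : ℕ} {p : Poly} (hp : p.IsHomogeneous n)
    (h : dunklLap κ p = 0) : HermiteEq κ ω n p := by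
  rw [HermiteEq, h, sum_X_mul_dunkl κ hp, reflSum_apply, sub_zero]

/-- The term of index `j` has degree `n - 2j` instead of `n`; the Laplacian of the preceding term
makes up for the defect, by `hermiteCoeff_succ`. -/
lemma hermiteEq_hermite {κ ω : ℝ} (hκ : 0 ≤ κ) (hω : 0 < ω) {y : Fin 3 → ℝ}
    (hy : y ∈ icosahedron) (n : ℕ) : HermiteEq κ ω n (hermite κ ω n y) := by
  set t : ℕ → Poly := fun j =>
    if 2 * j ≤ n then C (hermiteCoeff ω j) * ker κ (n - 2 * j) y else 0 with ht
  have hsum : hermite κ ω n y = ∑ j ∈ Finset.range (n + 1), t j := rfl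
  have hhom : ∀ j, (t j).IsHomogeneous (n - 2 * j) := by
    intro j
    simp only [ht]
    split_ifs
    · exact (isHomogeneous_ker κ _ y).C_mul _
    · exact isHomogeneous_zero _ _ _
  have hx : ∀ j, ∑ i, X i * dunkl κ i (t j) =
      C (n : ℝ) * t j + C κ * reflSum (t j) - C (2 * j : ℝ) * t j := by
    intro j
    rw [sum_X_mul_dunkl κ (hhom j), reflSum_apply]
    by_cases h : 2 * j ≤ n
    · rw [Nat.cast_sub h, C_sub]; push_cast; ring
    · simp [ht, h]
  have hlap : ∀ j, dunklLap κ (t j) = -(C (2 * ω) * (C (2 * (j + 1 : ℕ) : ℝ) * t (j + 1))) := by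
    intro j
    by_cases h : 2 * (j + 1) ≤ n
    · simp only [ht]
      rw [if_pos h, if_pos (by omega), dunklLap_C_mul,
        show n - 2 * j = n - 2 * (j + 1) + 2 by omega, dunklLap_ker hκ hy, ← mul_assoc, ← mul_assoc,
        ← mul_assoc, ← neg_mul, ← C_mul, ← C_mul, ← C_mul, ← C_neg]
      congr 2
      have := hermiteCoeff_succ hω j
      push_cast
      linarith
    · rw [dunklLap_eq_zero κ (hhom j) (by omega)]
      simp only [ht]
      rw [if_neg h]
      simp
  have hcomm : ∑ i, X i * dunkl κ i (hermite κ ω n y) =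
      ∑ j ∈ Finset.range (n + 1), ∑ i, X i * dunkl κ i (t j) := by
    rw [hsum, Finset.sum_comm]
    simp only [map_sum, Finset.mul_sum]
  have hshift : ∑ j ∈ Finset.range (n + 1), C (2 * j : ℝ) * t j =
      ∑ j ∈ Finset.range (n + 1), C (2 * (j + 1 : ℕ) : ℝ) * t (j + 1) := by
    have hlast : t (n + 1) = 0 := by
      simp only [ht]
      rw [if_neg (by omega)]
    rw [Finset.sum_range_succ', Finset.sum_range_succ (fun j => C (2 * (j + 1 : ℕ) : ℝ) * t (j + 1)),
      hlast]
    simp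
  rw [HermiteEq, hcomm, hsum, map_sum, map_sum]
  simp only [hx, hlap, Finset.sum_add_distrib, Finset.sum_sub_distrib, hshift, ← Finset.mul_sum,
    Finset.sum_neg_distrib]
  ring

/-! ### Orthogonality and reproducing properties from integration by parts. -/

/-- The properties of the normalized integral against `exp(-ω |x|²) h_κ(x)²`
that determine the inner products. -/
structure IsDunklGaussian (κ ω : ℝ) (E : Poly →ₗ[ℝ] ℝ) : Prop where
  apply_one : E 1 = 1
  apply_refl : ∀ v ∈ posRoots, ∀ p, E (refl v p) = E p
  by_parts : ∀ i p r,
    E (dunkl κ i p * r) + E (p * dunkl κ i r) = 2 * ω * E (X i * (p * r))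

lemma map_C_mul (E : Poly →ₗ[ℝ] ℝ) (a : ℝ) (p : Poly) : E (C a * p) = a * E p := by
  rw [← smul_eq_C_mul, map_smul, smul_eq_mul]

namespace IsDunklGaussian

variable {κ ω : ℝ} {E : Poly →ₗ[ℝ] ℝ}

/-- `2ω⟨x,T⟩ - Δ` is the operator of the Dirichlet form `∑ E(T_i p · T_i r)`; the symmetry of the
form is what gives orthogonality. -/
lemma dirichlet (hE : IsDunklGaussian κ ω E) (p r : Poly) :
    E (p * (C (2 * ω) * ∑ i, X i * dunkl κ i r - dunklLap κ r)) =
      ∑ i, E (dunkl κ i p * dunkl κ i r) := by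
  rw [mul_sub, map_sub, mul_left_comm, map_C_mul, Finset.mul_sum, map_sum, Finset.mul_sum,
    dunklLap_apply, Finset.mul_sum, map_sum, ← Finset.sum_sub_distrib]
  refine Finset.sum_congr rfl fun i _ => ?_
  rw [mul_left_comm p (X i), ← hE.by_parts]
  ring

lemma map_mul_refl (hE : IsDunklGaussian κ ω E) {v : Fin 3 → ℝ} (hv : v ∈ posRoots)
    (p r : Poly) : E (p * refl v r) = E (refl v p * r) := by
  rw [← hE.apply_refl v hv, map_mul, refl_refl (dotProduct_self_posRoots hv)]

lemma map_mul_reflSum (hE : IsDunklGaussian κ ω E) (p r : Poly) :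
    E (p * reflSum r) = E (reflSum p * r) := by
  simp only [reflSum_apply, Finset.mul_sum, Finset.sum_mul, map_sum, mul_sub, sub_mul, map_sub]
  exact Finset.sum_congr rfl fun v hv => by rw [hE.map_mul_refl hv]

lemma dirichlet_homogeneous (hE : IsDunklGaussian κ ω E) {r : Poly} {m : ℕ}
    (hr : r.IsHomogeneous m) (p : Poly) :
    ∑ i, E (dunkl κ i p * dunkl κ i r) =
      2 * ω * (m * E (p * r) + κ * E (p * reflSum r)) - E (p * dunklLap κ r) := by
  rw [← hE.dirichlet, sum_X_mul_dunkl κ hr, ← reflSum_apply, mul_sub, map_sub, mul_left_comm,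
    map_C_mul, mul_add, map_add, mul_left_comm, map_C_mul, mul_left_comm, map_C_mul]

/-- The Dirichlet form is computed with the operator on `p` and with it on `r`. The reflection terms
agree, so only the degrees and `Δ r` remain. -/
lemma sub_mul_map_mul (hE : IsDunklGaussian κ ω E) {p r : Poly} {m n : ℕ}
    (hp : HermiteEq κ ω n p) (hr : r.IsHomogeneous m) :
    2 * ω * (n - m) * E (p * r) = -E (p * dunklLap κ r) := by
  have h1 := hE.dirichlet_homogeneous hr p
  have h2 := hE.dirichlet r p
  rw [hp, mul_left_comm, map_C_mul, mul_add, map_add, mul_left_comm, map_C_mul, mul_left_comm,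
    map_C_mul, hE.map_mul_reflSum, mul_comm r p, mul_comm (reflSum r) p] at h2
  simp only [mul_comm (dunkl κ _ r)] at h2
  linarith

/-- Orthogonality to polynomials of lower degree. -/
lemma map_mul_eq_zero (hE : IsDunklGaussian κ ω E) (hω : 0 < ω) {p : Poly} {n : ℕ}
    (hp : HermiteEq κ ω n p) (m : ℕ) (hm : m < n) {r : Poly} (hr : r.IsHomogeneous m) :
    E (p * r) = 0 := by
  induction m using Nat.strong_induction_on generalizing r with
  | _ m ih =>
    have h := hE.sub_mul_map_mul hp hr
    have hz : E (p * dunklLap κ r) = 0 := by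
      by_cases h2 : m < 2
      · rw [dunklLap_eq_zero κ hr h2, mul_zero, map_zero]
      · exact ih (m - 2) (by omega) (by omega) (isHomogeneous_dunklLap κ hr)
    rw [hz, neg_zero] at h
    have hnm : (0 : ℝ) < n - m := sub_pos.2 (by exact_mod_cast hm)
    exact (mul_eq_zero.1 h).resolve_left (by positivity)

end IsDunklGaussian

/-- A maximum principle for the reflections acting on the vertices of the icosahedron. -/
lemma eq_zero_of_reflection_eq {c κ : ℝ} (hc : 0 < c) (hκ : 0 ≤ κ) {w : (Fin 3 → ℝ) → ℝ}
    (h : ∀ y ∈ icosahedron, c * w y + κ * ∑ v ∈ posRoots, (w y - w (reflV v y)) = 0)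
    {y : Fin 3 → ℝ} (hy : y ∈ icosahedron) : w y = 0 := by
  obtain ⟨z, hz, hmax⟩ := icosahedron.exists_max_image (fun y => |w y|) ⟨y, hy⟩
  -- At a maximum of `|w|` each of these products is nonnegative, so the equation multiplied by `w
  -- z` is a vanishing sum of nonnegative terms.
  have hsum : 0 ≤ ∑ v ∈ posRoots, w z * (w z - w (reflV v z)) := by
    refine Finset.sum_nonneg fun v hv => ?_
    have h1 := hmax _ (reflV_mem_icosahedron hv hz)
    have h2 : w z * w (reflV v z) ≤ |w z| * |w z| :=
      (le_abs_self _).trans (by rw [abs_mul]; gcongr)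
    rw [abs_mul_abs_self] at h2
    linarith
  have h3 : c * (w z * w z) + κ * ∑ v ∈ posRoots, w z * (w z - w (reflV v z)) = 0 := by
    rw [← Finset.mul_sum]
    linear_combination w z * h z hz
  have h4 : w z = 0 := by
    have : c * (w z * w z) ≤ 0 := by linarith [mul_nonneg hκ hsum]
    have := nonpos_of_mul_nonpos_right this hc
    exact mul_self_eq_zero.1 (le_antisymm this (mul_self_nonneg _))
  have := hmax y hy
  rw [h4, abs_zero] at this
  exact abs_nonpos_iff.1 this

namespace IsDunklGaussian

variable {κ ω : ℝ} {E : Poly →ₗ[ℝ] ℝ}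

/-- The reproducing property of the generalized Hermite polynomials. -/
lemma map_hermite_mul (hE : IsDunklGaussian κ ω E) (hκ : 0 ≤ κ) (hω : 0 < ω) (n : ℕ) {r : Poly}
    (hr : r.IsHomogeneous n) {y : Fin 3 → ℝ} (hy : y ∈ icosahedron) :
    (2 * ω) ^ n * E (hermite κ ω n y * r) = eval y r := by
  induction n generalizing r y with
  | zero =>
    rw [totalDegree_eq_zero_iff_eq_C.1 ((totalDegree_zero_iff_isHomogeneous _).2 hr), hermite_zero,
      one_mul, ← mul_one (C _), map_C_mul, hE.apply_one]
    simp
  | succ n ih =>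
    -- The unknown is the error in the identity, as a function of the vertex; `c = n + 1` is Euler's
    -- degree.
    refine sub_eq_zero.1 (eq_zero_of_reflection_eq (c := n + 1) (κ := κ) (by positivity) hκ
      (w := fun y => (2 * ω) ^ (n + 1) * E (hermite κ ω (n + 1) y * r) - eval y r)
      (fun y hy => ?_) hy)
    have h1 := hE.dirichlet_homogeneous hr (hermite κ ω (n + 1) y)
    have hlap : E (hermite κ ω (n + 1) y * dunklLap κ r) = 0 :=
      hE.map_mul_eq_zero hω (hermiteEq_hermite hκ hω hy (n + 1)) (n + 1 - 2) (by omega)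
        (isHomogeneous_dunklLap κ hr)
    -- Since `T_i H_{n+1} = y_i H_n`, the inductive hypothesis evaluates `T_i r` at `y`, and Euler's
    -- identity at the point `y` sums the results.
    have h2 : (2 * ω) ^ n * ∑ i, E (dunkl κ i (hermite κ ω (n + 1) y) * dunkl κ i r) =
        (n + 1) * eval y r + κ * ∑ v ∈ posRoots, (eval y r - eval (reflV v y) r) := by
      have h3 := congrArg (eval y) (sum_X_mul_dunkl κ hr)
      simp only [map_sum, map_add, map_mul, map_sub, eval_X, eval_C, eval_refl] at h3
      push_cast at h3
      rw [← h3, Finset.mul_sum]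
      refine Finset.sum_congr rfl fun i _ => ?_
      rw [dunkl_hermite_succ hκ ω i hy, mul_assoc, map_C_mul, mul_left_comm,
        ih (isHomogeneous_dunkl κ i hr) hy]
    have h4 : E (hermite κ ω (n + 1) y * reflSum r) = ∑ v ∈ posRoots,
        (E (hermite κ ω (n + 1) y * r) - E (hermite κ ω (n + 1) (reflV v y) * r)) := by
      rw [hE.map_mul_reflSum, reflSum_apply, Finset.sum_mul, map_sum]
      exact Finset.sum_congr rfl fun v hv => by rw [sub_mul, map_sub, refl_hermite hv]
    rw [h1, hlap, h4] at h2
    simp only [Finset.sum_sub_distrib, ← Finset.mul_sum] at h2 ⊢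
    push_cast at h2
    linear_combination h2

/-- The reproducing property for harmonic polynomials. -/
lemma map_ker_mul (hE : IsDunklGaussian κ ω E) (hκ : 0 ≤ κ) (hω : 0 < ω) {n : ℕ} {r : Poly}
    (hr : r.IsHomogeneous n) (hlap : dunklLap κ r = 0) {y : Fin 3 → ℝ} (hy : y ∈ icosahedron) :
    (2 * ω) ^ n * E (ker κ n y * r) = eval y r := by
  rw [← hE.map_hermite_mul hκ hω n hr hy, hermite, Finset.sum_range_succ']
  simp only [mul_zero, zero_le, if_true, tsub_zero]
  rw [show hermiteCoeff ω 0 = 1 by simp [hermiteCoeff], C_1, one_mul, add_mul, map_add,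
    Finset.sum_mul, map_sum, Finset.sum_eq_zero, zero_add]
  intro j _
  split_ifs with h
  -- A harmonic `r` of degree `n` itself satisfies `HermiteEq`, so it is orthogonal to the lower
  -- terms of the Hermite polynomial.
  · rw [mul_assoc, map_C_mul, mul_comm (ker _ _ _),
      hE.map_mul_eq_zero hω (hermiteEq_of_harmonic hr hlap) (n - 2 * (j + 1)) (by omega)
        (isHomogeneous_ker _ _ _), mul_zero]
  · rw [zero_mul, map_zero]

/-- Integration by parts against `X i`: Euler's identity gives `n`, its reflection terms having mean
zero, and `∑ T_i x_i = 3 + 30κ`. -/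
lemma map_normSq_mul (hE : IsDunklGaussian κ ω E) {p : Poly} {n : ℕ} (hp : p.IsHomogeneous n) :
    2 * ω * E (normSq * p) = (n + 3 + 30 * κ) * E p := by
  have h1 : 2 * ω * E (normSq * p) =
      E (∑ i, X i * dunkl κ i p) + E (p * ∑ i, dunkl κ i (X i * 1)) := by
    rw [normSq, Finset.sum_mul, Finset.mul_sum, map_sum, map_sum, map_sum, Finset.mul_sum,
      ← Finset.sum_add_distrib]
    refine Finset.sum_congr rfl fun i _ => ?_
    rw [mul_one, mul_comm (X i) (dunkl κ i p), hE.by_parts, sq, mul_assoc (X i), mul_comm p]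
  have h2 : ∑ i, dunkl κ i (X i * 1) = C (3 + 30 * κ) := by
    rw [sum_dunkl_X_mul, Finset.sum_eq_zero fun i _ => by
      rw [dunkl_eq_zero κ i (isHomogeneous_one _ _), mul_zero]]
    simp only [map_one, Finset.sum_const, card_posRoots, nsmul_eq_mul, C_mul, C_add,
      show (C 2 : Poly) = 2 from rfl, show (C 3 : Poly) = 3 from rfl,
      show (C 30 : Poly) = 30 from rfl]
    push_cast
    ring
  have h3 : E (∑ i, X i * dunkl κ i p) = n * E p := by
    rw [sum_X_mul_dunkl κ hp, map_add, map_C_mul, map_C_mul, map_sum,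
      Finset.sum_eq_zero fun v hv => by rw [map_sub, hE.apply_refl v hv, sub_self], mul_zero,
      add_zero]
  rw [h1, h2, h3, mul_comm p, map_C_mul]
  ring

lemma map_normSq_mul_mul (hE : IsDunklGaussian κ ω E) (hω : 0 < ω) {p r : Poly} {n m : ℕ}
    (hp : p.IsHomogeneous n) (hlap : dunklLap κ p = 0) (hr : r.IsHomogeneous m) (hm : m < n) :
    E (normSq * (p * r)) = 0 := by
  have h := hE.map_normSq_mul (hp.mul hr)
  rw [hE.map_mul_eq_zero hω (hermiteEq_of_harmonic hp hlap) m hm hr, mul_zero] at h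
  exact (mul_eq_zero.1 h).resolve_left (by positivity)

end IsDunklGaussian

/-! ### Harmonicity of `φ_n` and the inner product. -/

/-- The coefficient of `|x|^{2j} q_{n-2j}(x; y₀)` in `φ_n(x; y₀)`, up to the factor
`ν(n) / ν(n - 2j)`. -/
noncomputable def phiCoeff (κ : ℝ) (n j : ℕ) : ℝ :=
  (τ + 2) ^ j / (4 ^ j * (j.factorial : ℝ) * poch (-15 * κ - n + 1 / 2) j)

lemma poch_succ (a : ℝ) (j : ℕ) : poch a (j + 1) = poch a j * (a + j) := by
  simp [poch, ascPochhammer_succ_right]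

/-- All factors are at most `-15κ - 1/2`. -/
lemma poch_ne_zero {κ : ℝ} (hκ : 0 ≤ κ) {n j : ℕ} (hj : j ≤ n) :
    poch (-15 * κ - n + 1 / 2) j ≠ 0 := by
  induction j with
  | zero => simp [poch]
  | succ j ih =>
    rw [poch_succ]
    refine mul_ne_zero (ih (by omega)) (ne_of_lt ?_)
    have : (j + 1 : ℝ) ≤ n := by exact_mod_cast hj
    linarith

/-- The factor on the left is the constant of `dunklLap_normSq_pow_mul` in degree `n - 2(j+1)`; this
is the cancellation needed in `dunklLap_phi`. -/
lemma phiCoeff_succ {κ : ℝ} (hκ : 0 ≤ κ) {n j : ℕ} (hj : j + 1 ≤ n) :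
    phiCoeff κ n (j + 1) * (2 * (j + 1) * (2 * n - 2 * j - 1 + 30 * κ)) =
      -(phiCoeff κ n j * (τ + 2)) := by
  have h1 := poch_ne_zero hκ hj
  have h2 : (j.factorial : ℝ) ≠ 0 := by positivity
  rw [poch_succ] at h1
  have h3 := left_ne_zero_of_mul h1
  have h4 := right_ne_zero_of_mul h1
  rw [phiCoeff, phiCoeff, poch_succ, Nat.factorial_succ, pow_succ, pow_succ]
  push_cast
  generalize poch (-15 * κ - n + 1 / 2) j = P at *
  rw [show (2 * n - 2 * j - 1 + 30 * κ : ℝ) = -2 * (-15 * κ - n + 1 / 2 + j) by ring]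
  generalize (-15 * κ - n + 1 / 2 + j : ℝ) = Q at *
  field_simp
  ring

lemma phi_eq_ker {κ : ℝ} (n : ℕ) (y : Fin 3 → ℝ) :
    phi κ n y = C (nu κ n) * ∑ j ∈ Finset.range (n / 2 + 1),
      C (phiCoeff κ n j) * (normSq ^ j * ker κ (n - 2 * j) y) := by
  rw [phi, Finset.mul_sum]
  refine Finset.sum_congr rfl fun j _ => ?_
  rw [← phiCoeff, ker, div_eq_mul_inv (nu κ n), C_mul, C_mul]
  ring

lemma isHomogeneous_normSq_pow_mul_ker (κ : ℝ) {n j : ℕ} (hj : 2 * j ≤ n) (y : Fin 3 → ℝ) :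
    (normSq ^ j * ker κ (n - 2 * j) y).IsHomogeneous n := by
  have := (isHomogeneous_normSq.pow j).mul (isHomogeneous_ker κ (n - 2 * j) y)
  rwa [Nat.add_sub_cancel' hj] at this

lemma isHomogeneous_phi (κ : ℝ) (n : ℕ) (y : Fin 3 → ℝ) : (phi κ n y).IsHomogeneous n := by
  rw [phi_eq_ker]
  refine (IsHomogeneous.sum _ _ _ fun j hj => ?_).C_mul _
  rw [Finset.mem_range] at hj
  exact (isHomogeneous_normSq_pow_mul_ker κ (by omega) y).C_mul _

/-- The sum telescopes: `A j` is where `Δ` falls on the kernel, `B j` where it lowers the power of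
`|x|²`, and `A j + B (j + 1) = 0`. -/
lemma dunklLap_phi {κ : ℝ} (hκ : 0 ≤ κ) {y : Fin 3 → ℝ} (hy : y ∈ icosahedron) (n : ℕ) :
    dunklLap κ (phi κ n y) = 0 := by
  rw [phi_eq_ker, dunklLap_C_mul, map_sum]
  set A : ℕ → Poly := fun j => C (phiCoeff κ n j) * (normSq ^ j * dunklLap κ (ker κ (n - 2 * j) y))
    with hA
  set B : ℕ → Poly := fun j =>
    C (phiCoeff κ n j) * dunklLap κ (normSq ^ j * ker κ (n - 2 * j) y) - A j with hB
  have hsplit : ∀ j, dunklLap κ (C (phiCoeff κ n j) * (normSq ^ j * ker κ (n - 2 * j) y)) =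
      A j + B j := by
    intro j
    rw [dunklLap_C_mul, hB]
    ring
  have hA0 : A (n / 2) = 0 := by
    simp only [hA]
    rw [dunklLap_eq_zero κ (isHomogeneous_ker _ _ _) (by omega), mul_zero, mul_zero]
  have hB0 : B 0 = 0 := by simp [hA, hB]
  simp only [hsplit, Finset.sum_add_distrib]
  rw [Finset.sum_range_succ, hA0, Finset.sum_range_succ', hB0, add_zero, add_zero,
    ← Finset.sum_add_distrib, Finset.sum_eq_zero, mul_zero]
  intro j hj
  rw [Finset.mem_range] at hj
  have hcast : ((n - 2 * (j + 1) : ℕ) : ℝ) = n - 2 * (j + 1) := by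
    rw [Nat.cast_sub (by omega)]; push_cast; ring
  have h : C (phiCoeff κ n (j + 1)) * C (2 * (j + 1) * (2 * n - 2 * j - 1 + 30 * κ) : ℝ) =
      -((C (phiCoeff κ n j) : Poly) * C (τ + 2)) := by
    rw [← C_mul, ← C_mul, ← C_neg, phiCoeff_succ hκ (by omega)]
  simp only [hA, hB]
  rw [dunklLap_normSq_pow_mul κ (isHomogeneous_ker _ _ _), hcast,
    show n - 2 * j = n - 2 * (j + 1) + 2 by omega, dunklLap_ker hκ hy,
    show (2 * (j + 1) * (2 * (n - 2 * (j + 1)) + 2 * j + 3 + 30 * κ) : ℝ) =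
      2 * (j + 1) * (2 * n - 2 * j - 1 + 30 * κ) by ring]
  linear_combination (normSq ^ j * ker κ (n - 2 * (j + 1)) y) * h

lemma phi_eq_q_add {κ : ℝ} (hκ : 0 ≤ κ) (n : ℕ) (y : Fin 3 → ℝ) :
    phi κ n y = q κ n y + C (nu κ n) * ∑ j ∈ Finset.range (n / 2),
      C (phiCoeff κ n (j + 1)) * (normSq ^ (j + 1) * ker κ (n - 2 * (j + 1)) y) := by
  rw [phi_eq_ker, Finset.sum_range_succ', mul_add, mul_zero, tsub_zero, pow_zero, one_mul,
    show phiCoeff κ n 0 = 1 by simp [phiCoeff, poch], C_1, one_mul, C_nu_mul_ker hκ, add_comm]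

namespace IsDunklGaussian

variable {κ ω : ℝ} {E : Poly →ₗ[ℝ] ℝ}

/-- The inner product of `φ_n(·; y₀)` and `φ_n(·; y₁)`. -/
lemma map_phi_mul_phi (hE : IsDunklGaussian κ ω E) (hκ : 0 ≤ κ) (hω : 0 < ω) (n : ℕ)
    {y₀ y₁ : Fin 3 → ℝ} (hy₀ : y₀ ∈ icosahedron) (hy₁ : y₁ ∈ icosahedron) :
    E (phi κ n y₀ * phi κ n y₁) = nu κ n * (2 * ω) ^ (-(n : ℤ)) * eval y₀ (phi κ n y₁) := by
  have hlap := dunklLap_phi hκ hy₁ n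
  have hhom := isHomogeneous_phi κ n y₁
  rw [← hE.map_ker_mul hκ hω hhom hlap hy₀, phi_eq_q_add hκ n y₀, add_mul, map_add, mul_assoc,
    map_C_mul, Finset.sum_mul, map_sum, Finset.sum_eq_zero, mul_zero, add_zero, ← C_nu_mul_ker hκ,
    mul_assoc, map_C_mul, zpow_neg, zpow_natCast]
  · field_simp
  · intro j hj
    rw [Finset.mem_range] at hj
    -- One factor `|x|²` is split off, leaving degree `n - 2 < n`; hence every term but `ν(n) K_n`
    -- is orthogonal to the harmonic `φ_n(·;y₁)`.
    have h2 : (normSq ^ j * ker κ (n - 2 * (j + 1)) y₀).IsHomogeneous (n - 2) := by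
      have := isHomogeneous_normSq_pow_mul_ker κ (n := n - 2) (j := j) (by omega) y₀
      rwa [show n - 2 - 2 * j = n - 2 * (j + 1) by omega] at this
    have := hE.map_normSq_mul_mul hω hhom hlap h2 (by omega)
    rw [mul_assoc, map_C_mul, show normSq ^ (j + 1) * ker κ (n - 2 * (j + 1)) y₀ * phi κ n y₁ =
      normSq * (phi κ n y₁ * (normSq ^ j * ker κ (n - 2 * (j + 1)) y₀)) by ring, this, mul_zero]

end IsDunklGaussian

lemma eval_phi (κ : ℝ) (n : ℕ) {y₀ : Fin 3 → ℝ} (hy₀ : y₀ ∈ icosahedron) (y₁ : Fin 3 → ℝ) :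
    eval y₀ (phi κ n y₁) = ∑ j ∈ Finset.range (n / 2 + 1),
      (τ + 2) ^ (2 * j) / (4 ^ j * (j.factorial : ℝ) * poch (-15 * κ - n + 1 / 2) j) *
        (nu κ n / nu κ (n - 2 * j)) * eval y₀ (q κ (n - 2 * j) y₁) := by
  rw [phi, map_sum]
  refine Finset.sum_congr rfl fun j _ => ?_
  rw [map_mul, map_mul, map_pow, eval_C, eval_normSq, dotProduct_self_icosahedron hy₀]
  ring

/-! ### The regularized density: bounds and integration by parts. -/

open Filter Topology

/-- The density with the squares `⟨x, v⟩²` in the weight replaced by `⟨x, v⟩² + ε`. -/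
noncomputable def regDensity (κ ω ε : ℝ) (x : Fin 3 → ℝ) : ℝ :=
  Real.exp (-ω * (x ⬝ᵥ x)) * ∏ v ∈ posRoots, ((x ⬝ᵥ v) ^ 2 + ε) ^ κ

lemma regDensity_zero (κ ω : ℝ) : regDensity κ ω 0 = density κ ω := by
  ext x
  rw [regDensity, density, weight, ← Finset.prod_pow]
  congr 1
  refine Finset.prod_congr rfl fun v _ => ?_
  rw [add_zero, sq (_ ^ κ), ← Real.mul_rpow (abs_nonneg _) (abs_nonneg _), abs_mul_abs_self, sq]

lemma regDensity_nonneg (κ ω : ℝ) {ε : ℝ} (hε : 0 ≤ ε) (x : Fin 3 → ℝ) :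
    0 ≤ regDensity κ ω ε x :=
  mul_nonneg (Real.exp_pos _).le
    (Finset.prod_nonneg fun _ _ => Real.rpow_nonneg (add_nonneg (sq_nonneg _) hε) _)

@[fun_prop]
lemma continuous_dotProduct_left (v : Fin 3 → ℝ) : Continuous fun x : Fin 3 → ℝ => x ⬝ᵥ v := by
  simp only [dotProduct]
  fun_prop

@[fun_prop]
lemma continuous_dotProduct_self : Continuous fun x : Fin 3 → ℝ => x ⬝ᵥ x := by
  simp only [dotProduct]
  fun_prop

lemma continuous_regDensity {κ : ℝ} (hκ : 0 ≤ κ) (ω ε : ℝ) :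
    Continuous (regDensity κ ω ε) := by
  unfold regDensity
  refine Continuous.mul (by fun_prop) (continuous_finsetProd _ fun v _ => ?_)
  exact Continuous.rpow_const (by fun_prop) fun _ => Or.inr hκ

lemma continuous_regDensity_param {κ : ℝ} (hκ : 0 ≤ κ) (ω : ℝ) (x : Fin 3 → ℝ) :
    Continuous fun ε => regDensity κ ω ε x := by
  unfold regDensity
  refine Continuous.mul (by fun_prop) (continuous_finsetProd _ fun v _ => ?_)
  exact Continuous.rpow_const (by fun_prop) fun _ => Or.inr hκ

lemma integrable_pow_mul_exp {ω : ℝ} (hω : 0 < ω) (k : ℕ) :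
    Integrable fun t : ℝ => t ^ k * Real.exp (-ω * t ^ 2) := by
  have := integrable_rpow_mul_exp_neg_mul_sq hω (s := k) (by linarith [(k.cast_nonneg : (0 : ℝ) ≤ k)])
  simpa only [Real.rpow_natCast] using this

lemma integrable_eval_mul_exp {ω : ℝ} (hω : 0 < ω) (p : Poly) :
    Integrable fun x : Fin 3 → ℝ => eval x p * Real.exp (-ω * (x ⬝ᵥ x)) := by
  have h : (fun x : Fin 3 → ℝ => eval x p * Real.exp (-ω * (x ⬝ᵥ x))) = fun x =>
      ∑ d ∈ p.support, coeff d p * ∏ i, (x i ^ d i * Real.exp (-ω * x i ^ 2)) := by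
    ext x
    rw [eval_eq', Finset.sum_mul]
    refine Finset.sum_congr rfl fun d _ => ?_
    rw [Finset.prod_mul_distrib, ← Real.exp_sum, ← Finset.mul_sum, mul_assoc]
    simp [dotProduct, sq]
  rw [h]
  refine integrable_finsetSum _ fun d _ => Integrable.const_mul ?_ _
  exact Integrable.fintype_prod (f := fun i t => t ^ d i * Real.exp (-ω * t ^ 2))
    fun i => integrable_pow_mul_exp hω (d i)

/-- A polynomial dominating the weight. -/
noncomputable def weightBound (κ : ℝ) : Poly := ∏ v ∈ posRoots, (lin v ^ 2 + 1) ^ ⌈κ⌉₊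

/-- Raising the base to `⟨x,v⟩² + 1 ≥ 1` allows the exponent to be raised to an integer; the bound
is uniform in `ε ∈ [0, 1]`. -/
lemma regDensity_le {κ : ℝ} (hκ : 0 ≤ κ) (ω : ℝ) {ε : ℝ} (hε : 0 ≤ ε) (hε' : ε ≤ 1)
    (x : Fin 3 → ℝ) :
    regDensity κ ω ε x ≤ eval x (weightBound κ) * Real.exp (-ω * (x ⬝ᵥ x)) := by
  rw [regDensity, weightBound, mul_comm, map_prod]
  refine mul_le_mul_of_nonneg_right (Finset.prod_le_prod
    (fun _ _ => Real.rpow_nonneg (add_nonneg (sq_nonneg _) hε) _) fun v _ => ?_) (Real.exp_pos _).le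
  rw [map_pow, map_add, map_pow, map_one, eval_lin, ← Real.rpow_natCast _ ⌈κ⌉₊]
  calc ((x ⬝ᵥ v) ^ 2 + ε) ^ κ ≤ ((x ⬝ᵥ v) ^ 2 + 1) ^ κ :=
        Real.rpow_le_rpow (add_nonneg (sq_nonneg _) hε) (by linarith) hκ
    _ ≤ ((x ⬝ᵥ v) ^ 2 + 1) ^ (⌈κ⌉₊ : ℝ) :=
        Real.rpow_le_rpow_of_exponent_le (by linarith [sq_nonneg (x ⬝ᵥ v)]) (Nat.le_ceil κ)

/-- A common integrable bound for `p` times the regularized densities. -/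
noncomputable def domBound (κ ω : ℝ) (p : Poly) (x : Fin 3 → ℝ) : ℝ :=
  |eval x (p * weightBound κ) * Real.exp (-ω * (x ⬝ᵥ x))|

lemma integrable_domBound (κ : ℝ) {ω : ℝ} (hω : 0 < ω) (p : Poly) :
    Integrable (domBound κ ω p) :=
  (integrable_eval_mul_exp hω _).abs

lemma abs_eval_mul_regDensity_le {κ : ℝ} (hκ : 0 ≤ κ) (ω : ℝ) {ε : ℝ} (hε : 0 ≤ ε) (hε' : ε ≤ 1)
    (p : Poly) (x : Fin 3 → ℝ) : |eval x p * regDensity κ ω ε x| ≤ domBound κ ω p x := by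
  rw [domBound, map_mul, mul_assoc, abs_mul, abs_mul (eval x p)]
  gcongr
  · exact regDensity_nonneg κ ω hε x
  · exact regDensity_le hκ ω hε hε' x

lemma integrable_eval_mul_regDensity {κ ω ε : ℝ} (hκ : 0 ≤ κ) (hω : 0 < ω) (hε : 0 ≤ ε)
    (hε' : ε ≤ 1) (p : Poly) : Integrable fun x => eval x p * regDensity κ ω ε x :=
  (integrable_domBound κ hω p).mono'
    (((continuous_eval p).mul (continuous_regDensity hκ ω ε)).aestronglyMeasurable)
    (Eventually.of_forall fun x => abs_eval_mul_regDensity_le hκ ω hε hε' p x)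

lemma continuous_inv_sq_add {ε : ℝ} (hε : 0 < ε) (v : Fin 3 → ℝ) :
    Continuous fun x : Fin 3 → ℝ => ((x ⬝ᵥ v) ^ 2 + ε)⁻¹ :=
  Continuous.inv₀ (by fun_prop) fun x => by positivity

lemma integrable_inv_mul {κ ω ε : ℝ} (hκ : 0 ≤ κ) (hω : 0 < ω) (hε : 0 < ε)
    (hε' : ε ≤ 1) (v : Fin 3 → ℝ) (p : Poly) :
    Integrable fun x => ((x ⬝ᵥ v) ^ 2 + ε)⁻¹ * (eval x p * regDensity κ ω ε x) := by
  refine (integrable_eval_mul_regDensity hκ hω hε.le hε' p).bdd_mul (c := ε⁻¹)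
    (continuous_inv_sq_add hε v).aestronglyMeasurable (Eventually.of_forall fun x => ?_)
  have : 0 < (x ⬝ᵥ v) ^ 2 + ε := by positivity
  rw [Real.norm_eq_abs, abs_of_pos (inv_pos.2 this)]
  exact inv_anti₀ hε (by linarith [sq_nonneg (x ⬝ᵥ v)])

lemma hasDerivAt_coord (x : Fin 3 → ℝ) (i j : Fin 3) :
    HasDerivAt (fun t : ℝ => (x + t • (Pi.single i 1 : Fin 3 → ℝ)) j) ((Pi.single i 1 : Fin 3 → ℝ) j) 0 := by
  simpa using ((hasDerivAt_id (0 : ℝ)).mul_const ((Pi.single i 1 : Fin 3 → ℝ) j)).const_add (x j)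

lemma hasDerivAt_eval (p : Poly) (x : Fin 3 → ℝ) (i : Fin 3) :
    HasDerivAt (fun t : ℝ => eval (x + t • (Pi.single i 1 : Fin 3 → ℝ)) p) (eval x (pderiv i p)) 0 := by
  induction p using MvPolynomial.induction_on with
  | C a => simpa using hasDerivAt_const (0 : ℝ) a
  | add p r hp hr => simpa using hp.fun_add hr
  | mul_X p j hp =>
    have := hp.fun_mul (hasDerivAt_coord x i j)
    simp only [zero_smul, add_zero] at this
    simp only [map_mul, eval_X]
    refine this.congr_deriv ?_
    have h : eval x (pderiv i (X j)) = (Pi.single i 1 : Fin 3 → ℝ) j := by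
      rw [pderiv_X, Pi.single_apply, Pi.single_apply]
      split_ifs <;> simp
    rw [Derivation.leibniz, map_add, smul_eq_mul, smul_eq_mul, map_mul, map_mul, h, eval_X]
    ring

/-- The logarithmic derivative of a finite product of functions. -/
lemma hasDerivAt_finset_prod_log {ι : Type*} (s : Finset ι) {f : ι → ℝ → ℝ} {g : ι → ℝ} {a : ℝ}
    (h : ∀ v ∈ s, HasDerivAt (f v) (g v * f v a) a) :
    HasDerivAt (fun t => ∏ v ∈ s, f v t) ((∑ v ∈ s, g v) * ∏ v ∈ s, f v a) a := by
  classical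
  induction s using Finset.induction_on with
  | empty => simpa using hasDerivAt_const a (1 : ℝ)
  | insert v s hv ih =>
    have h1 := (h v (Finset.mem_insert_self _ _)).fun_mul
      (ih fun w hw => h w (Finset.mem_insert_of_mem hw))
    simp only [Finset.prod_insert hv, Finset.sum_insert hv]
    exact h1.congr_deriv (by ring)

lemma hasDerivAt_regDensity {κ ω ε : ℝ} (hε : 0 < ε) (x : Fin 3 → ℝ) (i : Fin 3) :
    HasDerivAt (fun t : ℝ => regDensity κ ω ε (x + t • (Pi.single i 1 : Fin 3 → ℝ)))
      ((-2 * ω * x i + ∑ v ∈ posRoots, 2 * κ * v i * (x ⬝ᵥ v) * ((x ⬝ᵥ v) ^ 2 + ε)⁻¹) *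
        regDensity κ ω ε x) 0 := by
  have hlin : ∀ v : Fin 3 → ℝ,
      HasDerivAt (fun t : ℝ => (x + t • (Pi.single i 1 : Fin 3 → ℝ)) ⬝ᵥ v) (v i) 0 := by
    intro v
    have := hasDerivAt_eval (lin v) x i
    simpa only [eval_lin, pderiv_lin, eval_C] using this
  have hexp : HasDerivAt (fun t : ℝ => Real.exp
      (-ω * ((x + t • (Pi.single i 1 : Fin 3 → ℝ)) ⬝ᵥ (x + t • (Pi.single i 1 : Fin 3 → ℝ)))))
      (-2 * ω * x i * Real.exp (-ω * (x ⬝ᵥ x))) 0 := by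
    have h1 := hasDerivAt_eval normSq x i
    have h2 : pderiv i normSq = 2 * X i := by
      simp [normSq, Derivation.leibniz_pow, pderiv_X, Pi.single_apply]
    simp only [eval_normSq, h2] at h1
    have h3 := (h1.const_mul (-ω)).exp
    simp only [zero_smul, add_zero, map_mul, eval_X, map_ofNat] at h3
    exact h3.congr_deriv (by ring)
  have hprod := hasDerivAt_finset_prod_log posRoots
    (f := fun v t => (((x + t • (Pi.single i 1 : Fin 3 → ℝ)) ⬝ᵥ v) ^ 2 + ε) ^ κ)
    (g := fun v => 2 * κ * v i * (x ⬝ᵥ v) * ((x ⬝ᵥ v) ^ 2 + ε)⁻¹) (a := 0) fun v _ => by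
      have hpos : 0 < (x ⬝ᵥ v) ^ 2 + ε := by positivity
      have h1 := (((hlin v).fun_pow 2).add_const ε).rpow_const (p := κ)
        (Or.inl (by simpa using hpos.ne'))
      refine h1.congr_deriv ?_
      simp only [zero_smul, add_zero]
      rw [Real.rpow_sub_one hpos.ne']
      push_cast
      field_simp
  have h := hexp.fun_mul hprod
  simp only [zero_smul, add_zero] at h
  exact h.congr_deriv (by rw [regDensity]; ring)

/-- Integration by parts against the regularized density. -/
lemma integral_regDensity_by_parts {κ ω ε : ℝ} (hκ : 0 ≤ κ) (hω : 0 < ω) (hε : 0 < ε)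
    (hε' : ε ≤ 1) (i : Fin 3) (p : Poly) :
    (∫ x, eval x (pderiv i p - C (2 * ω) * X i * p) * regDensity κ ω ε x) +
      ∑ v ∈ posRoots, κ * v i *
        ∫ x, ((x ⬝ᵥ v) ^ 2 + ε)⁻¹ * (eval x (lin v * (2 * p)) * regDensity κ ω ε x) = 0 := by
  set g' : (Fin 3 → ℝ) → ℝ := fun x =>
    eval x (pderiv i p - C (2 * ω) * X i * p) * regDensity κ ω ε x + ∑ v ∈ posRoots, κ * v i *
      (((x ⬝ᵥ v) ^ 2 + ε)⁻¹ * (eval x (lin v * (2 * p)) * regDensity κ ω ε x)) with hg'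
  have hterm : ∀ v ∈ posRoots, Integrable fun x : Fin 3 → ℝ => κ * v i *
      (((x ⬝ᵥ v) ^ 2 + ε)⁻¹ * (eval x (lin v * (2 * p)) * regDensity κ ω ε x)) :=
    fun v _ => (integrable_inv_mul hκ hω hε hε' v _).const_mul _
  have hint : Integrable g' :=
    (integrable_eval_mul_regDensity hκ hω hε.le hε' _).add (integrable_finsetSum _ hterm)
  have hderiv : ∀ x, HasLineDerivAt ℝ (fun x => eval x p * regDensity κ ω ε x) (g' x) x
      ((Pi.single i 1 : Fin 3 → ℝ)) := by
    intro x
    have h := (hasDerivAt_eval p x i).fun_mul (hasDerivAt_regDensity (κ := κ) (ω := ω) hε x i)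
    simp only [zero_smul, add_zero] at h
    rw [HasLineDerivAt]
    refine h.congr_deriv ?_
    have hsum : ∑ v ∈ posRoots, κ * v i *
        (((x ⬝ᵥ v) ^ 2 + ε)⁻¹ * (eval x (lin v * (2 * p)) * regDensity κ ω ε x)) =
        eval x p * (∑ v ∈ posRoots, 2 * κ * v i * (x ⬝ᵥ v) * ((x ⬝ᵥ v) ^ 2 + ε)⁻¹) *
          regDensity κ ω ε x := by
      rw [Finset.mul_sum, Finset.sum_mul]
      refine Finset.sum_congr rfl fun v _ => ?_
      rw [map_mul, map_mul, map_ofNat, eval_lin]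
      ring
    simp only [hg']
    rw [hsum, map_sub, map_mul, map_mul, eval_C, eval_X]
    ring
  -- Paired with the constant 1, this says that a line derivative has integral zero.
  have hzero := integral_bilinear_hasLineDerivAt_right_eq_neg_left_of_integrable (μ := volume)
    (B := ContinuousLinearMap.mul ℝ ℝ) (f := fun _ : Fin 3 → ℝ => (1 : ℝ)) (f' := fun _ => 0)
    (g := fun x => eval x p * regDensity κ ω ε x) (g' := g') (v := (Pi.single i 1 : Fin 3 → ℝ))
    (by simp) (by simpa using hint)
    (by simpa using integrable_eval_mul_regDensity hκ hω hε.le hε' p)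
    (fun x _ => by simpa [HasLineDerivAt] using hasDerivAt_const (0 : ℝ) (1 : ℝ))
    (fun x _ => hderiv x)
  simp only [ContinuousLinearMap.mul_apply', one_mul, zero_mul, integral_zero, neg_zero] at hzero
  rw [← hzero, hg', integral_add (integrable_eval_mul_regDensity hκ hω hε.le hε' _)
    (integrable_finsetSum _ hterm), integral_finsetSum _ hterm]
  simp only [integral_const_mul]

/-! ### Reflection invariance and cancellation of the singular terms. -/

/-- The reflection `reflV v` as a linear map. -/
noncomputable def reflLin (v : Fin 3 → ℝ) : (Fin 3 → ℝ) →ₗ[ℝ] (Fin 3 → ℝ) where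
  toFun := reflV v
  map_add' x y := by
    ext i
    simp only [reflV, add_dotProduct, Pi.sub_apply, Pi.add_apply, Pi.smul_apply, smul_eq_mul]
    ring
  map_smul' a x := by
    ext i
    simp only [reflV, smul_dotProduct, Pi.sub_apply, Pi.smul_apply, smul_eq_mul, RingHom.id_apply]
    ring

lemma continuous_reflV (v : Fin 3 → ℝ) : Continuous (reflV v) :=
  (reflLin v).continuous_of_finiteDimensional

lemma measurePreserving_reflV {v : Fin 3 → ℝ} (hv : v ⬝ᵥ v = 4) :
    MeasurePreserving (reflV v) := by
  refine ⟨(continuous_reflV v).measurable, ?_⟩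
  have hcomp : reflLin v ∘ₗ reflLin v = LinearMap.id := LinearMap.ext fun x => reflV_reflV hv x
  -- An involution has determinant `±1`.
  have hdet : LinearMap.det (reflLin v) * LinearMap.det (reflLin v) = 1 := by
    rw [← LinearMap.det_comp, hcomp, LinearMap.det_id]
  have habs : |LinearMap.det (reflLin v)| = 1 := by
    rcases mul_self_eq_one_iff.1 hdet with h | h <;> simp [h]
  have hne : LinearMap.det (reflLin v) ≠ 0 := left_ne_zero_of_mul_eq_one hdet
  have h := Real.map_linearMap_volume_pi_eq_smul_volume_pi hne
  rw [abs_inv, habs, inv_one, ENNReal.ofReal_one, one_smul] at h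
  exact h

lemma integral_comp_reflV {v : Fin 3 → ℝ} (hv : v ⬝ᵥ v = 4) (f : (Fin 3 → ℝ) → ℝ) :
    ∫ x, f (reflV v x) = ∫ x, f x :=
  (measurePreserving_reflV hv).integral_comp
    (MeasurableEquiv.ofInvolutive (reflV v) (reflV_reflV hv)
      (continuous_reflV v).measurable).measurableEmbedding f

lemma regDensity_reflV {v : Fin 3 → ℝ} (hv : v ∈ posRoots) (κ ω ε : ℝ) (x : Fin 3 → ℝ) :
    regDensity κ ω ε (reflV v x) = regDensity κ ω ε x := by
  rw [regDensity, regDensity, reflV_dotProduct, reflV_reflV (dotProduct_self_posRoots hv)]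
  simp only [reflV_dotProduct]
  rw [prod_posRoots_reflV hv (f := fun w => ((x ⬝ᵥ w) ^ 2 + ε) ^ κ) fun w => by
    rw [dotProduct_neg, neg_sq]]

lemma reflV_dotProduct_self {v : Fin 3 → ℝ} (hv : v ⬝ᵥ v = 4) (x : Fin 3 → ℝ) :
    reflV v x ⬝ᵥ v = -(x ⬝ᵥ v) := by
  simp only [reflV, sub_dotProduct, smul_dotProduct, hv, smul_eq_mul]
  ring

/-- The singular terms of a reflection-invariant polynomial cancel. -/
lemma integral_inv_mul_eq_zero {v : Fin 3 → ℝ} (hv : v ∈ posRoots) (κ ω ε : ℝ) {p : Poly}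
    (hp : refl v p = p) :
    ∫ x, ((x ⬝ᵥ v) ^ 2 + ε)⁻¹ * (eval x (lin v * p) * regDensity κ ω ε x) = 0 := by
  have hv4 := dotProduct_self_posRoots hv
  have h := integral_comp_reflV hv4
    fun x => ((x ⬝ᵥ v) ^ 2 + ε)⁻¹ * (eval x (lin v * p) * regDensity κ ω ε x)
  have h2 : ∀ x, eval (reflV v x) p = eval x p := fun x => by rw [← eval_refl, hp]
  simp only [reflV_dotProduct_self hv4, regDensity_reflV hv, map_mul, eval_lin, h2, neg_sq,
    neg_mul, mul_neg, integral_neg] at h ⊢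
  linarith

/-- `2pr` splits into `⟨x,v⟩` times the divided-difference terms and a reflection-invariant rest.
Against the odd kernel the rest integrates to zero; the other part carries `⟨x,v⟩²`, which controls
the denominator as `ε → 0`. -/
lemma integral_regDensity_dunkl {κ ω ε : ℝ} (hκ : 0 ≤ κ) (hω : 0 < ω) (hε : 0 < ε)
    (hε' : ε ≤ 1) (i : Fin 3) (p r : Poly) :
    (∫ x, eval x (pderiv i (p * r) - C (2 * ω) * X i * (p * r)) * regDensity κ ω ε x) +
      ∑ v ∈ posRoots, κ * v i * ∫ x, ((x ⬝ᵥ v) ^ 2 + ε)⁻¹ *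
        (eval x (lin v ^ 2 * (divDiff v p * r + p * divDiff v r)) * regDensity κ ω ε x) = 0 := by
  rw [← integral_regDensity_by_parts hκ hω hε hε' i (p * r)]
  congr 1
  refine Finset.sum_congr rfl fun v hv => ?_
  congr 1
  have hp := lin_mul_divDiff v p
  have hr := lin_mul_divDiff v r
  have hsplit : lin v * (2 * (p * r)) = lin v ^ 2 * (divDiff v p * r + p * divDiff v r) +
      lin v * (refl v p * r + p * refl v r) := by
    linear_combination -lin v * r * hp - lin v * p * hr
  have hinv : refl v (refl v p * r + p * refl v r) = refl v p * r + p * refl v r := by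
    rw [map_add, map_mul, map_mul, refl_refl (dotProduct_self_posRoots hv),
      refl_refl (dotProduct_self_posRoots hv)]
    ring
  have h0 := integral_inv_mul_eq_zero hv κ ω ε hinv
  have hadd := integral_add
    (integrable_inv_mul hκ hω hε hε' v (lin v ^ 2 * (divDiff v p * r + p * divDiff v r)))
    (integrable_inv_mul hκ hω hε hε' v (lin v * (refl v p * r + p * refl v r)))
  rw [h0, add_zero] at hadd
  rw [← hadd, hsplit]
  refine integral_congr_ae (Eventually.of_forall fun x => ?_)
  simp only [map_add (eval x) (lin v ^ 2 * _)]
  ring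

/-! ### Removing the regularization. -/

/-- The sequence of regularization parameters `1 / (n + 1)`. -/
noncomputable def regSeq (n : ℕ) : ℝ := 1 / ((n : ℝ) + 1)

lemma regSeq_pos (n : ℕ) : 0 < regSeq n := Nat.one_div_pos_of_nat

lemma regSeq_le_one (n : ℕ) : regSeq n ≤ 1 := by
  rw [regSeq, div_le_one (by positivity)]
  linarith [(n.cast_nonneg : (0 : ℝ) ≤ n)]

lemma tendsto_regSeq : Tendsto regSeq atTop (𝓝 0) := tendsto_one_div_add_atTop_nhds_zero_nat

lemma tendsto_regDensity {κ : ℝ} (hκ : 0 ≤ κ) (ω : ℝ) (x : Fin 3 → ℝ) :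
    Tendsto (fun n => regDensity κ ω (regSeq n) x) atTop (𝓝 (density κ ω x)) := by
  rw [← regDensity_zero]
  exact ((continuous_regDensity_param hκ ω x).tendsto 0).comp tendsto_regSeq

lemma tendsto_integral_regDensity {κ ω : ℝ} (hκ : 0 ≤ κ) (hω : 0 < ω) (p : Poly) :
    Tendsto (fun n => ∫ x, eval x p * regDensity κ ω (regSeq n) x) atTop
      (𝓝 (∫ x, eval x p * density κ ω x)) :=
  tendsto_integral_of_dominated_convergence (domBound κ ω p)
    (fun n => ((continuous_eval p).mul
      (continuous_regDensity hκ ω (regSeq n))).aestronglyMeasurable)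
    (integrable_domBound κ hω p)
    (fun n => Eventually.of_forall fun x =>
      abs_eval_mul_regDensity_le hκ ω (regSeq_pos n).le (regSeq_le_one n) p x)
    (Eventually.of_forall fun x => (tendsto_regDensity hκ ω x).const_mul _)

lemma density_eq_zero {κ : ℝ} (hκ : κ ≠ 0) (ω : ℝ) {v : Fin 3 → ℝ} (hv : v ∈ posRoots)
    {x : Fin 3 → ℝ} (hx : x ⬝ᵥ v = 0) : density κ ω x = 0 := by
  rw [density, weight, Finset.prod_eq_zero hv (by rw [hx, abs_zero, Real.zero_rpow hκ])]
  ring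

/-- The quotient `⟨x,v⟩² / (⟨x,v⟩² + ε)` is at most 1 and tends to 1 off the mirror. On the mirror
the limiting density is zero if `κ ≠ 0`, and for `κ = 0` the prefactor is zero, so convergence holds
at every point. -/
lemma tendsto_integral_inv_mul {κ ω : ℝ} (hκ : 0 ≤ κ) (hω : 0 < ω) {v : Fin 3 → ℝ}
    (hv : v ∈ posRoots) (p : Poly) :
    Tendsto (fun n => κ * ∫ x, ((x ⬝ᵥ v) ^ 2 + regSeq n)⁻¹ *
      (eval x (lin v ^ 2 * p) * regDensity κ ω (regSeq n) x)) atTop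
      (𝓝 (κ * ∫ x, eval x p * density κ ω x)) := by
  rcases eq_or_ne κ 0 with rfl | hκ0
  · simp
  have hrw : ∀ n x, ((x ⬝ᵥ v) ^ 2 + regSeq n)⁻¹ *
      (eval x (lin v ^ 2 * p) * regDensity κ ω (regSeq n) x) =
      (x ⬝ᵥ v) ^ 2 / ((x ⬝ᵥ v) ^ 2 + regSeq n) *
        (eval x p * regDensity κ ω (regSeq n) x) := by
    intro n x
    rw [map_mul, map_pow, eval_lin]
    ring
  refine Tendsto.const_mul _ (tendsto_integral_of_dominated_convergence (domBound κ ω p)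
    (fun n => (integrable_inv_mul hκ hω (regSeq_pos n) (regSeq_le_one n) v _).aestronglyMeasurable)
    (integrable_domBound κ hω p) (fun n => Eventually.of_forall fun x => ?_)
    (Eventually.of_forall fun x => ?_))
  · have hpos : 0 < (x ⬝ᵥ v) ^ 2 + regSeq n := add_pos_of_nonneg_of_pos (sq_nonneg _) (regSeq_pos n)
    rw [hrw, Real.norm_eq_abs, abs_mul, abs_of_nonneg (div_nonneg (sq_nonneg _) hpos.le)]
    refine (mul_le_of_le_one_left (abs_nonneg _) ?_).trans
      (abs_eval_mul_regDensity_le hκ ω (regSeq_pos n).le (regSeq_le_one n) p x)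
    rw [div_le_one hpos]
    linarith [regSeq_pos n]
  · simp only [hrw]
    rcases eq_or_ne (x ⬝ᵥ v) 0 with hx | hx
    · rw [density_eq_zero hκ0 ω hv hx, hx]
      simp
    · have h1 : Tendsto (fun n => (x ⬝ᵥ v) ^ 2 / ((x ⬝ᵥ v) ^ 2 + regSeq n)) atTop (𝓝 1) := by
        have : Tendsto (fun n => (x ⬝ᵥ v) ^ 2 / ((x ⬝ᵥ v) ^ 2 + regSeq n)) atTop
            (𝓝 ((x ⬝ᵥ v) ^ 2 / ((x ⬝ᵥ v) ^ 2 + 0))) := (tendsto_const_nhds (x := (x ⬝ᵥ v) ^ 2)).div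
          (tendsto_regSeq.const_add ((x ⬝ᵥ v) ^ 2)) (by simpa using hx)
        simpa [hx] using this
      simpa using h1.mul ((tendsto_regDensity hκ ω x).const_mul (eval x p))

lemma integrable_eval_mul_density {κ ω : ℝ} (hκ : 0 ≤ κ) (hω : 0 < ω) (p : Poly) :
    Integrable fun x => eval x p * density κ ω x := by
  rw [← regDensity_zero]
  exact integrable_eval_mul_regDensity hκ hω le_rfl zero_le_one p

/-- The normalized integral of a polynomial against the density, as a linear functional. -/
noncomputable def gaussianMean {κ ω : ℝ} (hκ : 0 ≤ κ) (hω : 0 < ω) : Poly →ₗ[ℝ] ℝ where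
  toFun p := normConst κ ω * ∫ x, eval x p * density κ ω x
  map_add' p r := by
    simp only [map_add, add_mul]
    rw [integral_add (integrable_eval_mul_density hκ hω p) (integrable_eval_mul_density hκ hω r),
      mul_add]
  map_smul' a p := by
    simp only [smul_eval, mul_assoc, integral_const_mul, smul_eq_mul, RingHom.id_apply]
    ring

lemma gaussianMean_apply {κ ω : ℝ} (hκ : 0 ≤ κ) (hω : 0 < ω) (p : Poly) :
    gaussianMean hκ hω p = normConst κ ω * ∫ x, eval x p * density κ ω x := rfl

/-- An explicit point off all mirrors; by continuity of the density it makes the normalizing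
integral positive. -/
lemma dotZ_generic : ∀ v ∈ rootsZ, dotZ ![(1, 0), (10, 0), (100, 0)] v ≠ 0 := by decide +kernel

lemma exists_density_ne_zero (κ ω : ℝ) : ∃ x, density κ ω x ≠ 0 := by
  refine ⟨evV ![(1, 0), (10, 0), (100, 0)], ?_⟩
  refine mul_ne_zero (Real.exp_pos _).ne' (pow_ne_zero _ (Finset.prod_ne_zero_iff.2 fun v hv => ?_))
  obtain ⟨w, hw, rfl⟩ := exists_of_mem_posRoots hv
  have h : evV ![(1, 0), (10, 0), (100, 0)] ⬝ᵥ evV w ≠ 0 := by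
    rw [← evZ_dotZ]
    intro h0
    exact dotZ_generic w hw (evZ_injective (h0.trans (by simp [evZ])))
  exact (Real.rpow_pos_of_pos (abs_pos.2 h) _).ne'

lemma integral_density_pos {κ ω : ℝ} (hκ : 0 ≤ κ) (hω : 0 < ω) : 0 < ∫ x, density κ ω x := by
  obtain ⟨x, hx⟩ := exists_density_ne_zero κ ω
  refine integral_pos_of_integrable_nonneg_nonzero (x := x) ?_ ?_ ?_ hx
  · rw [← regDensity_zero]
    exact continuous_regDensity hκ ω 0
  · simpa using integrable_eval_mul_density hκ hω 1
  · rw [← regDensity_zero]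
    exact fun x => regDensity_nonneg κ ω le_rfl x

lemma isDunklGaussian_gaussianMean {κ ω : ℝ} (hκ : 0 ≤ κ) (hω : 0 < ω) :
    IsDunklGaussian κ ω (gaussianMean hκ hω) where
  apply_one := by
    rw [gaussianMean_apply, normConst]
    simp only [map_one, one_mul]
    exact inv_mul_cancel₀ (integral_density_pos hκ hω).ne'
  apply_refl v hv p := by
    rw [gaussianMean_apply, gaussianMean_apply,
      ← integral_comp_reflV (dotProduct_self_posRoots hv) fun x => eval x p * density κ ω x]
    simp only [← regDensity_zero, regDensity_reflV hv, eval_refl]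
  by_parts i p r := by
    have h1 := (tendsto_integral_regDensity hκ hω
      (pderiv i (p * r) - C (2 * ω) * X i * (p * r))).add
      (tendsto_finsetSum posRoots fun v hv => (tendsto_integral_inv_mul hκ hω hv
        (divDiff v p * r + p * divDiff v r)).const_mul (v i))
    have h2 : ∀ n, (∫ x, eval x (pderiv i (p * r) - C (2 * ω) * X i * (p * r)) *
        regDensity κ ω (regSeq n) x) + ∑ v ∈ posRoots, v i * (κ * ∫ x,
          ((x ⬝ᵥ v) ^ 2 + regSeq n)⁻¹ * (eval x (lin v ^ 2 * (divDiff v p * r + p * divDiff v r)) *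
            regDensity κ ω (regSeq n) x)) = 0 := by
      intro n
      rw [← integral_regDensity_dunkl hκ hω (regSeq_pos n) (regSeq_le_one n) i p r]
      congr 1
      exact Finset.sum_congr rfl fun v _ => by ring
    simp only [h2] at h1
    have h3 := tendsto_nhds_unique h1 tendsto_const_nhds
    have h4 : gaussianMean hκ hω (pderiv i (p * r) - C (2 * ω) * X i * (p * r)) +
        ∑ v ∈ posRoots, gaussianMean hκ hω
          (C κ * (C (v i) * (divDiff v p * r + p * divDiff v r))) = 0 := by
      simp only [map_C_mul, gaussianMean_apply]
      rw [← mul_zero (normConst κ ω), ← h3, mul_add, Finset.mul_sum]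
      congr 1
      exact Finset.sum_congr rfl fun v _ => by ring
    rw [← map_sum, ← map_add] at h4
    -- With the invariant part gone, the divided differences obey an untwisted Leibniz rule and
    -- recombine into Dunkl operators.
    have h5 : pderiv i (p * r) - C (2 * ω) * X i * (p * r) +
        ∑ v ∈ posRoots, C κ * (C (v i) * (divDiff v p * r + p * divDiff v r)) =
        dunkl κ i p * r + p * dunkl κ i r - C (2 * ω) * (X i * (p * r)) := by
      simp only [dunkl_apply, Derivation.leibniz, smul_eq_mul, mul_add, Finset.sum_add_distrib,
        add_mul, Finset.mul_sum, Finset.sum_mul]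
      simp only [mul_assoc, mul_left_comm p]
      ring
    rw [h5, map_sub, map_add, map_C_mul] at h4
    linarith

end Icosahedral

theorem mainTheorem7 (κ ω : ℝ) (hκ : 0 ≤ κ) (hω : 0 < ω) (n : ℕ) (y₀ y₁ : Fin 3 → ℝ)
    (hy₀ : y₀ ∈ Icosahedral.icosahedron) (hy₁ : y₁ ∈ Icosahedral.icosahedron) :
    Integrable (fun x : Fin 3 → ℝ =>
        MvPolynomial.eval x (Icosahedral.phi κ n y₀) *
          MvPolynomial.eval x (Icosahedral.phi κ n y₁) * Icosahedral.density κ ω x) ∧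
      Icosahedral.inner₂ κ ω (Icosahedral.phi κ n y₀) (Icosahedral.phi κ n y₁) =
        ∑ j ∈ Finset.range (n / 2 + 1),
          (2 * ω) ^ (-(n : ℤ)) * (Icosahedral.τ + 2) ^ (2 * j) /
              (4 ^ j * (j.factorial : ℝ) * Icosahedral.poch (-15 * κ - n + 1 / 2) j) *
            (Icosahedral.nu κ n ^ 2 / Icosahedral.nu κ (n - 2 * j)) *
            MvPolynomial.eval y₀ (Icosahedral.q κ (n - 2 * j) y₁) ∧
      Icosahedral.inner₂ κ ω (Icosahedral.phi κ n y₀) (Icosahedral.phi κ n y₁) =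
        Icosahedral.nu κ n * (2 * ω) ^ (-(n : ℤ)) *
          MvPolynomial.eval y₁ (Icosahedral.phi κ n y₀) := by
  have hE := Icosahedral.isDunklGaussian_gaussianMean hκ hω
  have hinner : Icosahedral.inner₂ κ ω (Icosahedral.phi κ n y₀) (Icosahedral.phi κ n y₁) =
      Icosahedral.gaussianMean hκ hω (Icosahedral.phi κ n y₀ * Icosahedral.phi κ n y₁) := by
    simp only [Icosahedral.inner₂, Icosahedral.gaussianMean_apply, map_mul]
  refine ⟨?_, ?_, ?_⟩
  · simpa only [map_mul] using Icosahedral.integrable_eval_mul_density hκ hω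
      (Icosahedral.phi κ n y₀ * Icosahedral.phi κ n y₁)
  · rw [hinner, hE.map_phi_mul_phi hκ hω n hy₀ hy₁, Icosahedral.eval_phi κ n hy₀ y₁,
      Finset.mul_sum]
    exact Finset.sum_congr rfl fun j _ => by ring
  -- The roles of the vertices are exchanged, so that the evaluation is at `y₁`.
  · rw [hinner, mul_comm (Icosahedral.phi κ n y₀), hE.map_phi_mul_phi hκ hω n hy₁ hy₀]
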